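/- Let $K_2=\{\mathrm{diag}(1,0),\mathrm{diag}(-1,0)\}\subset\mathbb R^{2\times 2}$. For $K\subset\mathbb R^{2\times 2}$ let $K^{(lc)}=\bigcup_{j\ge 0}K^{(j)}$ be its lamination convex hull, where $K^{(0)}=K$ and $K^{(j+1)}=K^{(j)}\cup\{\lambda A+(1-\lambda)B:\ A,B\in K^{(j)},\ \mathrm{rank}(A-B)=1,\ \lambda\in[0,1]\}$. Let $p\in[1,\infty)$ and $F\in K_2^{(lc)}\setminus K_2$. For $\epsilon>0$ and $u\in W^{1,p}_{loc}(\mathbb R^2,\mathbb R^2)$ with weak gradient $\nabla u$ put $$E^{(p)}_\epsilon(u)=\int_{[0,1]^2}\mathrm{dist}^p(\nabla u,K_2)\,dx+\epsilon\,\|D^2u\|_{TV((0,1)^2)}\in[0,\infty],$$ where $\mathrm{dist}$ is taken with respect to the Euclidean (Frobenius) norm and $\|D^2u\|_{TV((0,1)^2)}$ is the total variation on $(0,1)^2$ of the distributional derivative of $\nabla u$ (equal to $\infty$ if that derivative is not a finite measure on $(0,1)^2$). Let $$\mathcal A^p_F=\{u\in W^{1,p}_{loc}(\mathbb R^2,\mathbb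 R^2):\ u(x)=Fx+b \text{ for a.e. } x\in\mathbb R^2\setminus[0,1]^2, \text{ for some } b\in\mathbb R^2\},\qquad E^{(p)}_\epsilon(F)=\inf_{u\in\mathcal A^p_F}E^{(p)}_\epsilon(u).$$ **Theorem.** There exist constants $0<c\le C$, depending only on $p$, $F$ and $K_2$, such that for every $\epsilon\in(0,1)$ $$c\,\epsilon^{\frac{p}{p+1}}\le E^{(p)}_\epsilon(F)\le C\,\epsilon^{\frac{p}{p+1}}.$$ -/

import Mathlib

open MeasureTheory
open scoped ENNReal Distributions

-- Matrices carry the Frobenius (Euclidean) norm.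
attribute [local instance] Matrix.frobeniusNormedAddCommGroup

/-- The Euclidean plane. -/
abbrev Plane : Type := EuclideanSpace ℝ (Fin 2)

/-- Real `2 × 2` matrices. -/
abbrev Mat2 : Type := Matrix (Fin 2) (Fin 2) ℝ

/-- The closed unit square `[0,1]²`. -/
def unitSquare : Set Plane := {x | ∀ i, x i ∈ Set.Icc (0 : ℝ) 1}

/-- The open unit square `(0,1)²`. -/
def openUnitSquare : TopologicalSpace.Opens Plane where
  carrier := {x | ∀ i, x i ∈ Set.Ioo (0 : ℝ) 1}
  is_open' := by
    simp only [Set.ofPred_forall]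
    exact isOpen_iInter_of_finite fun i => isOpen_Ioo.preimage (by fun_prop)

/-- The sets `K^(j)` of laminates of order at most `j` generated by `K`. -/
def laminates {m n : ℕ} (K : Set (Matrix (Fin m) (Fin n) ℝ)) :
    ℕ → Set (Matrix (Fin m) (Fin n) ℝ)
  | 0 => K
  | j + 1 => laminates K j ∪
      {M | ∃ A ∈ laminates K j, ∃ B ∈ laminates K j, ∃ t ∈ Set.Icc (0 : ℝ) 1,
        (A - B).rank = 1 ∧ M = t • A + (1 - t) • B}

/-- The lamination convex hull `K^(lc)`. -/
def laminationConvexHull {m n : ℕ} (K : Set (Matrix (Fin m) (Fin n) ℝ)) :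
    Set (Matrix (Fin m) (Fin n) ℝ) :=
  ⋃ j, laminates K j

/-- The two wells `diag(1,0)` and `diag(-1,0)`. -/
def wellsK2 : Set Mat2 := {!![1, 0; 0, 0], !![-1, 0; 0, 0]}

/-- The partial derivative `∂_j φ (x)` of a test function on the plane. -/
noncomputable def testPartial {U : TopologicalSpace.Opens Plane} (φ : 𝓓(U, ℝ)) (j : Fin 2)
    (x : Plane) : ℝ :=
  fderiv ℝ (φ : Plane → ℝ) x (EuclideanSpace.single j 1)

/-- `G` is a weak gradient of `u : ℝ² → ℝ²` on the whole plane: both are locally integrable and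
`∫ u_i ∂_j φ = - ∫ G_{ij} φ` for all `φ ∈ C_c^∞(ℝ²)`. -/
structure IsWeakGradient (u : Plane → Plane) (G : Plane → Mat2) : Prop where
  locallyIntegrable_fun : ∀ i, LocallyIntegrable (fun x => u x i) volume
  locallyIntegrable_grad : ∀ i j, LocallyIntegrable (fun x => G x i j) volume
  integral_eq : ∀ (i j : Fin 2) (φ : 𝓓((⊤ : TopologicalSpace.Opens Plane), ℝ)),
    ∫ x, u x i * testPartial φ j x = -∫ x, G x i j * φ x

/-- Membership in `W^{1,p}_loc(ℝ², ℝ²)`. -/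
def MemW1pLoc (p : ℝ) (u : Plane → Plane) : Prop :=
  ∃ G : Plane → Mat2, IsWeakGradient u G ∧
    ∀ S : Set Plane, IsCompact S →
      (∀ i, MemLp (fun x => u x i) (ENNReal.ofReal p) (volume.restrict S)) ∧
      ∀ i j, MemLp (fun x => G x i j) (ENNReal.ofReal p) (volume.restrict S)

/-- The total variation on the open set `U` of the distributional derivative of a matrix field
`G`, by duality with test fields `φ ∈ C_c^∞(U; ℝ^{2×2×2})` such that `|φ| ≤ 1` pointwise in the
Euclidean norm. It is `∞` if this derivative is not a finite measure on `U`. -/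
noncomputable def totalVariation (U : TopologicalSpace.Opens Plane) (G : Plane → Mat2) : ℝ≥0∞ :=
  ⨆ (φ : Fin 2 → Fin 2 → Fin 2 → 𝓓(U, ℝ))
    (_ : ∀ x, ∑ i, ∑ j, ∑ k, (φ i j k x) ^ 2 ≤ 1),
    ENNReal.ofReal (∫ x in (U : Set Plane), ∑ i, ∑ j, ∑ k, G x i j * testPartial (φ i j k) k x)

/-- The energy `∫_{[0,1]²} dist^p(G, K) dx + ε ‖DG‖_{TV((0,1)²)}` in terms of the gradient `G`. -/
noncomputable def gradEnergy (K : Set Mat2) (p ε : ℝ) (G : Plane → Mat2) : ℝ≥0∞ :=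
  (∫⁻ x in unitSquare, Metric.infEDist (G x) K ^ p) +
    ENNReal.ofReal ε * totalVariation openUnitSquare G

/-- The energy `E_ε^{(p)}(u) = ∫_{[0,1]²} dist^p(∇u, K) dx + ε ‖D²u‖_{TV((0,1)²)}`. The infimum
is over the representatives `G` of the weak gradient `∇u`; its value does not depend on the
representative, see `energy_eq_gradEnergy`. -/
noncomputable def energy (K : Set Mat2) (p ε : ℝ) (u : Plane → Plane) : ℝ≥0∞ :=
  ⨅ (G : Plane → Mat2) (_ : IsWeakGradient u G), gradEnergy K p ε G

/-- The admissible deformations `𝒜_F^p`: functions in `W^{1,p}_loc(ℝ², ℝ²)` with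
`u(x) = F x + b` (almost everywhere) outside `[0,1]²`, for some `b ∈ ℝ²`. -/
def admissible (p : ℝ) (F : Mat2) : Set (Plane → Plane) :=
  {u | MemW1pLoc p u ∧
    ∃ b : Plane, ∀ᵐ x ∂(volume : Measure Plane), x ∉ unitSquare →
      u x = F.toEuclideanLin x + b}

/-- The minimal energy `E_ε^{(p)}(F) = inf_{u ∈ 𝒜_F^p} E_ε^{(p)}(u)`. -/
noncomputable def minEnergy (K : Set Mat2) (p ε : ℝ) (F : Mat2) : ℝ≥0∞ :=
  ⨅ u ∈ admissible p F, energy K p ε u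

theorem IsWeakGradient.ae_eq {u : Plane → Plane} {G H : Plane → Mat2}
    (hG : IsWeakGradient u G) (hH : IsWeakGradient u H) : G =ᵐ[volume] H := by
  have key : ∀ i j, ∀ᵐ x ∂(volume : Measure Plane), G x i j - H x i j = 0 := by
    intro i j
    refine ae_eq_zero_of_integral_contDiff_smul_eq_zero
      ((hG.locallyIntegrable_grad i j).sub (hH.locallyIntegrable_grad i j)) ?_
    intro g hg hgs
    let φ : 𝓓((⊤ : TopologicalSpace.Opens Plane), ℝ) := ⟨g, hg, hgs, fun _ _ => trivial⟩
    have h1 := hG.integral_eq i j φ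
    have h2 := hH.integral_eq i j φ
    have h3 : ∫ x, G x i j * g x = ∫ x, H x i j * g x := neg_injective (h1.symm.trans h2)
    have iG : Integrable (fun x => G x i j * g x) := by
      simpa [smul_eq_mul, mul_comm] using
        (hG.locallyIntegrable_grad i j).integrable_smul_left_of_hasCompactSupport
          hg.continuous hgs
    have iH : Integrable (fun x => H x i j * g x) := by
      simpa [smul_eq_mul, mul_comm] using
        (hH.locallyIntegrable_grad i j).integrable_smul_left_of_hasCompactSupport
          hg.continuous hgs
    have : (fun x => g x • (G x i j - H x i j)) = fun x => G x i j * g x - H x i j * g x := by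
      funext x; simp only [smul_eq_mul]; ring
    refine (congrArg (integral volume) this).trans ?_
    rw [integral_sub iG iH, h3, sub_self]
  have key' : ∀ᵐ x ∂(volume : Measure Plane), ∀ i j, G x i j - H x i j = 0 :=
    ae_all_iff.2 fun i => ae_all_iff.2 fun j => key i j
  filter_upwards [key'] with x hx
  ext i j
  exact sub_eq_zero.1 (hx i j)

theorem gradEnergy_congr {K : Set Mat2} {p ε : ℝ} {G H : Plane → Mat2}
    (h : G =ᵐ[volume] H) : gradEnergy K p ε G = gradEnergy K p ε H := by
  unfold gradEnergy totalVariation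
  congr 1
  · refine lintegral_congr_ae (ae_restrict_of_ae ?_)
    filter_upwards [h] with x hx
    rw [hx]
  · congr 1
    refine iSup_congr fun φ => iSup_congr fun _ => congrArg _ ?_
    refine integral_congr_ae (ae_restrict_of_ae ?_)
    filter_upwards [h] with x hx
    rw [hx]

/-- The energy can be computed with any representative of the weak gradient. -/
theorem energy_eq_gradEnergy {K : Set Mat2} {p ε : ℝ} {u : Plane → Plane} {G : Plane → Mat2}
    (hG : IsWeakGradient u G) : energy K p ε u = gradEnergy K p ε G :=
  le_antisymm (iInf₂_le G hG)
    (le_iInf₂ fun _ hH => (gradEnergy_congr (hG.ae_eq hH)).le)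

/-! Outside the wells, the hull consists of the matrices `diag(μ, 0)` with `|μ| < 1`, and only the
first row of the gradient matters. The exponent comes from a competition between the vertical
derivative, which must be small, and the boundary condition, which forces horizontal oscillation
with many interfaces.

Lower bound. Let `w` be the first component of `u` minus its affine boundary datum, and let `X` be
the energy. Then `w` vanishes outside the square, `∂₁w` has `L¹` norm at most `X^(1/p)`, and the
total variation of `∂₀w` in direction `0` is at most `X/ε`. Replacing a test function by its average
over segments of length `δ` in direction `0` costs `δ` times that total variation. The averaged test
function has a derivative of size `2/δ`, and the integral of `w` against it is controlled by a
Poincaré inequality in the vertical direction. By duality `∫ |∂₀w| ≤ δ X/ε + (2/δ) X^(1/p)` on the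
left half of the square (`HasWeakGradient.setIntegral_abs_grad_le`). But `∂₀u₀` is close to `±1`,
hence away from `μ`, so the left side is at least `(1-|μ|)/2 - X^(1/p)`. The choice `δ ~ ε/X` gives
`X^((p+1)/p) ≳ ε` (`exists_rpow_le_of_interpolation`).

Upper bound. The deformation is `μ x₀` plus a minimum of cones. A cone has horizontal slopes `1-μ`
and `-(1+μ)`, so the sum has slope `±1` wherever a cone is the minimum. Generation `j` has vertices
at spacing `1/(N 2^j)` and is raised with the distance `r` to the horizontal sides at rate `σ_j =
(ρ^j-1)/N`. Finer generations therefore win only near these sides, where `r ≲ (2ρ)^(-j)`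
(`roof_le_branchDepth`), and this produces the refinement without any cell-by-cell description. With
`ρ^p = 2` the elastic energy is at most of order `∑ (ρ^j/N)^p (2ρ)^(-j) = N^(-p) ∑ ρ^(-j)`. The
interfaces contribute `∑ N 2^j (2ρ)^(-j) = N ∑ ρ^(-j)`. Choosing `N ~ ε^(-1/(p+1))` balances
`N^(-p)` and `ε N`.

The gradient is read off by touching: where the minimum equals one of its members, their derivatives
agree (`lineDeriv_eq_of_le`). Its variation is bounded on lines, on which each member is minimal on
an interval (`exists_ordConnected_minimizer_partition`). -/

/-! ### Averages of smooth functions along segments -/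

section SegmentAverage

variable {E F : Type} [NormedAddCommGroup E] [NormedSpace ℝ E]
  [NormedAddCommGroup F] [NormedSpace ℝ F]

/-- The average `∫₀¹ k(r) ψ(x - r v) dr` of `ψ` along a segment of direction `v`. -/
noncomputable def segmentAverage (k : ℝ → ℝ) (v : E) (ψ : E → F) (x : E) : F :=
  ∫ r in (0 : ℝ)..1, k r • ψ (x - r • v)

variable {k : ℝ → ℝ} {v : E} {ψ : E → F}

/-- Differentiation under the integral sign. The derivative is again a segment average, which is
what makes an induction on smoothness possible. -/
theorem hasFDerivAt_segmentAverage (hk : Continuous k) (hψ : ContDiff ℝ 1 ψ)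
    (hc : HasCompactSupport ψ) (x : E) :
    HasFDerivAt (segmentAverage k v ψ) (segmentAverage k v (fderiv ℝ ψ) x) x := by
  have hd : Continuous (fderiv ℝ ψ) := hψ.continuous_fderiv one_ne_zero
  obtain ⟨C, hC⟩ := hd.bounded_above_of_compact_support (hc.fderiv ℝ)
  refine intervalIntegral.hasFDerivAt_integral_of_dominated_of_fderiv_le
    (s := Set.univ) (bound := fun r => |k r| * C)
    (F' := fun y r => k r • fderiv ℝ ψ (y - r • v)) Filter.univ_mem (.of_forall fun y => ?_) ?_ ?_ ?_ ?_ ?_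
  · have := hψ.continuous
    exact (by fun_prop : Continuous fun r : ℝ => k r • ψ (y - r • v)).aestronglyMeasurable
  · have := hψ.continuous
    exact (by fun_prop : Continuous fun r : ℝ => k r • ψ (x - r • v)).intervalIntegrable _ _
  · exact (by fun_prop :
      Continuous fun r : ℝ => k r • fderiv ℝ ψ (x - r • v)).aestronglyMeasurable
  · refine .of_forall fun r _ y _ => ?_
    rw [norm_smul, Real.norm_eq_abs]
    gcongr
    exact hC _
  · exact (by fun_prop : Continuous fun r : ℝ => |k r| * C).intervalIntegrable _ _
  · refine .of_forall fun r _ y _ => ?_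
    have h1 : HasFDerivAt ψ (fderiv ℝ ψ (y - r • v)) (y - r • v) :=
      (hψ.differentiable one_ne_zero _).hasFDerivAt
    have h2 : HasFDerivAt (fun y : E => y - r • v) (ContinuousLinearMap.id ℝ E) y :=
      (hasFDerivAt_id y).sub_const _
    simpa [Function.comp_def, Pi.smul_def] using (h1.comp y h2).const_smul (k r)

theorem continuous_segmentAverage (hk : Continuous k) (hψ : Continuous ψ) :
    Continuous (segmentAverage k v ψ) :=
  intervalIntegral.continuous_parametric_intervalIntegral_of_continuous' (by fun_prop) _ _

/-- The codomain is quantified after `n` because the induction step applies the hypothesis to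
`fderiv ℝ ψ`, whose values are linear maps. -/
theorem contDiff_segmentAverage_nat (hk : Continuous k) (n : ℕ) :
    ∀ {F : Type} [NormedAddCommGroup F] [NormedSpace ℝ F] {ψ : E → F},
      ContDiff ℝ n ψ → HasCompactSupport ψ → ContDiff ℝ n (segmentAverage k v ψ) := by
  induction n with
  | zero =>
    intro F _ _ ψ hψ hc
    simp only [Nat.cast_zero, contDiff_zero] at hψ ⊢
    exact continuous_segmentAverage hk hψ
  | succ n ih =>
    intro F _ _ ψ hψ hc
    have h1 : ContDiff ℝ 1 ψ := hψ.of_le (by exact_mod_cast Nat.le_add_left 1 n)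
    rw [Nat.cast_add, Nat.cast_one, contDiff_succ_iff_hasFDerivAt (n := (n : ℕ))]
    refine ⟨_, ?_, fun x => hasFDerivAt_segmentAverage hk h1 hc x⟩
    exact ih ((contDiff_succ_iff_fderiv.1 (by exact_mod_cast hψ)).2.2) (hc.fderiv ℝ)

theorem contDiff_segmentAverage (hk : Continuous k) (hψ : ContDiff ℝ (⊤ : ℕ∞) ψ)
    (hc : HasCompactSupport ψ) : ContDiff ℝ (⊤ : ℕ∞) (segmentAverage k v ψ) :=
  contDiff_infty.2 fun n =>
    contDiff_segmentAverage_nat hk n (hψ.of_le (by exact_mod_cast le_top)) hc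

theorem tsupport_segmentAverage_subset (hc : HasCompactSupport ψ) :
    tsupport (segmentAverage k v ψ) ⊆
      (fun z : ℝ × E => z.2 + z.1 • v) '' (Set.Icc 0 1 ×ˢ tsupport ψ) := by
  refine closure_minimal ?_ ((isCompact_Icc.prod hc).image (by fun_prop)).isClosed
  intro x hx
  by_contra hne
  refine hx ?_
  unfold segmentAverage
  rw [intervalIntegral.integral_congr (g := fun _ => (0 : F)), intervalIntegral.integral_zero]
  intro r hr
  rw [Set.uIcc_of_le zero_le_one] at hr
  have : ψ (x - r • v) = 0 := by
    by_contra h0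
    exact hne ⟨(r, x - r • v), ⟨hr, subset_tsupport _ h0⟩, by simp⟩
  simp [this]

theorem hasCompactSupport_segmentAverage (hc : HasCompactSupport ψ) :
    HasCompactSupport (segmentAverage k v ψ) :=
  ((isCompact_Icc.prod hc).image (by fun_prop)).of_isClosed_subset (isClosed_tsupport _)
    (tsupport_segmentAverage_subset hc)

theorem norm_segmentAverage_le {M : ℝ} (hk : ∀ r ∈ Set.Icc (0 : ℝ) 1, |k r| ≤ 1)
    (hψ : ∀ x, ‖ψ x‖ ≤ M) (x : E) : ‖segmentAverage k v ψ x‖ ≤ M := by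
  have := intervalIntegral.norm_integral_le_of_norm_le_const (a := (0 : ℝ)) (b := 1) (C := M)
    (f := fun r : ℝ => k r • ψ (x - r • v)) ?_
  · simpa [segmentAverage] using this
  intro r hr
  rw [Set.uIoc_of_le zero_le_one] at hr
  rw [norm_smul, Real.norm_eq_abs]
  calc _ ≤ 1 * M := mul_le_mul (hk r ⟨hr.1.le, hr.2⟩) (hψ _) (norm_nonneg _) zero_le_one
    _ = M := one_mul M

theorem fderiv_segmentAverage_apply [CompleteSpace F] (hk : Continuous k) (hψ : ContDiff ℝ 1 ψ)
    (hc : HasCompactSupport ψ) (x w : E) :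
    fderiv ℝ (segmentAverage k v ψ) x w =
      ∫ r in (0 : ℝ)..1, k r • fderiv ℝ ψ (x - r • v) w := by
  have hd : Continuous (fderiv ℝ ψ) := hψ.continuous_fderiv one_ne_zero
  rw [(hasFDerivAt_segmentAverage hk hψ hc x).fderiv, segmentAverage,
    ContinuousLinearMap.intervalIntegral_apply]
  · simp
  · exact (by fun_prop :
      Continuous fun r : ℝ => k r • fderiv ℝ ψ (x - r • v)).intervalIntegrable _ _

theorem hasDerivAt_comp_sub_smul (hψ : ContDiff ℝ 1 ψ) (x : E) (r : ℝ) :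
    HasDerivAt (fun r : ℝ => ψ (x - r • v)) (-fderiv ℝ ψ (x - r • v) v) r := by
  have h1 : HasFDerivAt ψ (fderiv ℝ ψ (x - r • v)) (x - r • v) :=
    (hψ.differentiable one_ne_zero _).hasFDerivAt
  have h2 : HasDerivAt (fun r : ℝ => x - r • v) (-((1 : ℝ) • v)) r :=
    ((hasDerivAt_id r).smul_const v).const_sub x
  simpa [Function.comp_def] using h1.comp_hasDerivAt r h2

/-- In the direction `v` the integrand is `-d/dr ψ(x - r v)`, so the integral telescopes. -/
theorem fderiv_segmentAverage_one [CompleteSpace F] (hψ : ContDiff ℝ 1 ψ)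
    (hc : HasCompactSupport ψ) (x : E) :
    fderiv ℝ (segmentAverage (fun _ => 1) v ψ) x v = ψ x - ψ (x - v) := by
  have hd : Continuous (fderiv ℝ ψ) := hψ.continuous_fderiv one_ne_zero
  rw [fderiv_segmentAverage_apply continuous_const hψ hc]
  have := intervalIntegral.integral_eq_sub_of_hasDerivAt (a := 0) (b := 1)
    (fun r _ => (hasDerivAt_comp_sub_smul (v := v) hψ x r).fun_neg)
    ((by fun_prop : Continuous fun r : ℝ => - -fderiv ℝ ψ (x - r • v) v).intervalIntegrable _ _)
  simp only [neg_neg] at this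
  simp only [one_smul, this, zero_smul, sub_zero]
  abel

/-- Integration by parts in `r`; the weight `1 - r` removes the endpoint `r = 1`. It exhibits the
error of averaging as an exact derivative along `v`, of a function bounded by the sup of `ψ`. -/
theorem fderiv_segmentAverage_one_sub [CompleteSpace F] (hψ : ContDiff ℝ 1 ψ)
    (hc : HasCompactSupport ψ) (x : E) :
    fderiv ℝ (segmentAverage (fun r => 1 - r) v ψ) x v =
      ψ x - segmentAverage (fun _ => 1) v ψ x := by
  have hd : Continuous (fderiv ℝ ψ) := hψ.continuous_fderiv one_ne_zero
  have hψc := hψ.continuous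
  rw [fderiv_segmentAverage_apply (by fun_prop) hψ hc, segmentAverage]
  have hD : ∀ r : ℝ, HasDerivAt (fun r : ℝ => (r - 1) • ψ (x - r • v))
      ((1 - r) • fderiv ℝ ψ (x - r • v) v + (1 : ℝ) • ψ (x - r • v)) r := by
    intro r
    have h1 : HasDerivAt (fun r : ℝ => r - 1) 1 r := (hasDerivAt_id r).sub_const 1
    convert h1.fun_smul (hasDerivAt_comp_sub_smul (v := v) hψ x r) using 2
    rw [smul_neg, ← neg_smul, neg_sub]
  have i1 : IntervalIntegrable (fun r : ℝ => (1 - r) • fderiv ℝ ψ (x - r • v) v) volume 0 1 :=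
    (by fun_prop : Continuous fun r : ℝ => (1 - r) • fderiv ℝ ψ (x - r • v) v).intervalIntegrable
      _ _
  have i2 : IntervalIntegrable (fun r : ℝ => (1 : ℝ) • ψ (x - r • v)) volume 0 1 :=
    (by fun_prop : Continuous fun r : ℝ => (1 : ℝ) • ψ (x - r • v)).intervalIntegrable _ _
  have := intervalIntegral.integral_eq_sub_of_hasDerivAt (a := 0) (b := 1)
    (fun r _ => hD r) (i1.add i2)
  rw [intervalIntegral.integral_add i1 i2] at this
  rw [eq_sub_iff_add_eq, this]
  simp

end SegmentAverage

/-! ### The `L¹` norm by duality with smooth test functions -/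

section Duality

variable {E : Type*} [NormedAddCommGroup E] [NormedSpace ℝ E] [FiniteDimensional ℝ E]

/-- Smooth Urysohn functions for a compact subset of an open set, as test functions. -/
theorem exists_testFunction_eq_one {K V : Set E} {U : TopologicalSpace.Opens E}
    (hK : IsCompact K) (hV : IsOpen V) (hKV : K ⊆ V) (hVU : V ⊆ U) :
    ∃ f : 𝓓(U, ℝ), (∀ x ∈ K, f x = 1) ∧ (∀ x, f x ∈ Set.Icc (0 : ℝ) 1) ∧
      ∀ x, x ∉ V → f x = 0 := by
  obtain ⟨W, hW, hKW, hWV, hWc⟩ := exists_open_between_and_isCompact_closure hK hV hKV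
  obtain ⟨f, hf, hr, hs, h1⟩ := exists_contMDiff_support_eq_eq_one_iff (modelWithCornersSelf ℝ E)
    (n := ⊤) hW hK.isClosed hKW
  have hts : tsupport f = closure W := by rw [tsupport, hs]
  refine ⟨⟨f, contMDiff_iff_contDiff.1 hf, ?_, ?_⟩, fun x hx => (h1 x).1 hx,
    fun x => hr ⟨x, rfl⟩, fun x hx => ?_⟩
  · rw [HasCompactSupport, hts]; exact hWc
  · rw [hts]; exact hWV.trans hVU
  · by_contra h0
    exact hx (hWV (subset_closure (hs ▸ (h0 : x ∈ Function.support f))))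

variable [MeasurableSpace E] [BorelSpace E] {μ : Measure E}

/-- The sign of `g` is approximated by a difference of Urysohn functions of compact subsets of `{g >
0}` and `{g < 0}`, supported in disjoint open sets. -/
theorem setIntegral_abs_le_of_forall_testFunction_aux {U : TopologicalSpace.Opens E} {g : E → ℝ}
    (hm : Measurable g) (hg : IntegrableOn g U μ) {M : ℝ}
    (h : ∀ ψ : 𝓓(U, ℝ), (∀ x, |ψ x| ≤ 1) → ∫ x in U, g x * ψ x ∂μ ≤ M) :
    ∫ x in U, |g x| ∂μ ≤ M := by
  have hU : MeasurableSet (U : Set E) := U.isOpen.measurableSet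
  -- Inner regularity is applied to the finite measure `|g| μ`, so that the leftover sets are small
  -- for the integral of `|g|`.
  set ν : Measure E := (μ.restrict U).withDensity fun x => ‖g x‖ₑ with hν
  have : IsFiniteMeasure ν := isFiniteMeasure_withDensity hg.hasFiniteIntegral.ne
  have hν' : ∀ {A : Set E}, MeasurableSet A →
      ∫ x in U, A.indicator (fun x => |g x|) x ∂μ = (ν A).toReal := by
    intro A hA
    rw [integral_indicator hA, hν, withDensity_apply _ hA,
      ← integral_norm_eq_lintegral_enorm (hg.integrable.restrict).aestronglyMeasurable]
    rfl
  refine le_of_forall_pos_le_add fun ε hε => ?_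
  -- Off the compact sets the loss is at most `2|g|`, on two leftover sets; `ε / 4` each makes a
  -- total of `ε`.
  have hε' : ENNReal.ofReal (ε / 4) ≠ 0 := (ENNReal.ofReal_pos.2 (by positivity)).ne'
  have hPm : MeasurableSet ({x | 0 < g x} ∩ U) := (measurableSet_lt measurable_const hm).inter hU
  have hNm : MeasurableSet ({x | g x < 0} ∩ U) := (measurableSet_lt hm measurable_const).inter hU
  obtain ⟨K₁, hK₁, hK₁c, hK₁ν⟩ := hPm.exists_isCompact_sdiff_lt (μ := ν) (measure_ne_top _ _) hε'
  obtain ⟨K₂, hK₂, hK₂c, hK₂ν⟩ := hNm.exists_isCompact_sdiff_lt (μ := ν) (measure_ne_top _ _) hε'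
  have hdis : Disjoint K₁ K₂ := by
    refine Set.disjoint_left.2 fun x h1 h2 => ?_
    exact lt_asymm (show 0 < g x from (hK₁ h1).1) (show g x < 0 from (hK₂ h2).1)
  obtain ⟨V₁, V₂, hV₁, hV₂, hKV₁, hKV₂, hVV⟩ :=
    SeparatedNhds.of_isCompact_isCompact hK₁c hK₂c hdis
  obtain ⟨f₁, h11, h1r, h10⟩ := exists_testFunction_eq_one (U := U) hK₁c (hV₁.inter U.isOpen)
    (Set.subset_inter hKV₁ fun x hx => (hK₁ hx).2) Set.inter_subset_right
  obtain ⟨f₂, h21, h2r, h20⟩ := exists_testFunction_eq_one (U := U) hK₂c (hV₂.inter U.isOpen)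
    (Set.subset_inter hKV₂ fun x hx => (hK₂ hx).2) Set.inter_subset_right
  have hψ1 : ∀ x, |(f₁ - f₂) x| ≤ 1 := by
    intro x
    have a1 := h1r x
    have a2 := h2r x
    rw [show (f₁ - f₂) x = f₁ x - f₂ x from rfl, abs_le]
    constructor <;> linarith [a1.1, a1.2, a2.1, a2.2]
  have hpt : ∀ x ∈ (U : Set E), |g x| ≤ g x * (f₁ - f₂) x +
      2 * ((({x | 0 < g x} ∩ U) \ K₁).indicator (fun x => |g x|) x +
        (({x | g x < 0} ∩ U) \ K₂).indicator (fun x => |g x|) x) := by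
    intro x hx
    have hlow : -|g x| ≤ g x * (f₁ - f₂) x := by
      have := abs_le.1 (show |g x * (f₁ - f₂) x| ≤ |g x| by
        rw [abs_mul]; exact mul_le_of_le_one_right (abs_nonneg _) (hψ1 x))
      exact this.1
    have n1 := Set.indicator_nonneg (s := ({x | 0 < g x} ∩ U) \ K₁) (f := fun x => |g x|)
      (fun _ _ => abs_nonneg _) x
    have n2 := Set.indicator_nonneg (s := ({x | g x < 0} ∩ U) \ K₂) (f := fun x => |g x|)
      (fun _ _ => abs_nonneg _) x
    by_cases hk1 : x ∈ K₁
    · have hf1 : (f₁ - f₂) x = 1 := by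
        rw [show (f₁ - f₂) x = f₁ x - f₂ x from rfl, h11 x hk1, h20 x, sub_zero]
        exact fun hv => Set.disjoint_left.1 hVV (hKV₁ hk1) hv.1
      rw [hf1, mul_one, abs_of_pos (hK₁ hk1).1]
      linarith
    by_cases hk2 : x ∈ K₂
    · have hf2 : (f₁ - f₂) x = -1 := by
        rw [show (f₁ - f₂) x = f₁ x - f₂ x from rfl, h21 x hk2, h10 x, zero_sub]
        exact fun hv => Set.disjoint_left.1 hVV hv.1 (hKV₂ hk2)
      rw [hf2, mul_neg_one, abs_of_neg (hK₂ hk2).1]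
      linarith
    rcases lt_trichotomy (g x) 0 with hlt | heq | hgt
    · have hmem : x ∈ ({x | g x < 0} ∩ (U : Set E)) \ K₂ := ⟨⟨hlt, hx⟩, hk2⟩
      rw [Set.indicator_of_mem hmem]
      linarith
    · simp only [heq, abs_zero, zero_mul, zero_add] at n1 n2 ⊢
      linarith
    · have hmem : x ∈ ({x | 0 < g x} ∩ (U : Set E)) \ K₁ := ⟨⟨hgt, hx⟩, hk1⟩
      rw [Set.indicator_of_mem hmem]
      linarith
  have iψ : IntegrableOn (fun x => g x * (f₁ - f₂) x) U μ := by
    refine Integrable.mono hg (hg.aestronglyMeasurable.mul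
      (f₁ - f₂).continuous.aestronglyMeasurable) (.of_forall fun x => ?_)
    rw [norm_mul]
    exact mul_le_of_le_one_right (norm_nonneg _) (hψ1 x)
  have i1 : IntegrableOn ((({x | 0 < g x} ∩ U) \ K₁).indicator (fun x => |g x|)) U μ :=
    (Integrable.abs hg).indicator (hPm.diff hK₁c.measurableSet)
  have i2 : IntegrableOn ((({x | g x < 0} ∩ U) \ K₂).indicator (fun x => |g x|)) U μ :=
    (Integrable.abs hg).indicator (hNm.diff hK₂c.measurableSet)
  have i12 : IntegrableOn (fun x => (({x | 0 < g x} ∩ U) \ K₁).indicator (fun x => |g x|) x +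
      (({x | g x < 0} ∩ U) \ K₂).indicator (fun x => |g x|) x) U μ := i1.add i2
  have hlt : ∀ {A : Set E}, ν A < ENNReal.ofReal (ε / 4) → (ν A).toReal ≤ ε / 4 := fun hA =>
    ENNReal.toReal_le_of_le_ofReal (by positivity) hA.le
  calc ∫ x in U, |g x| ∂μ ≤ ∫ x in U, (g x * (f₁ - f₂) x +
      2 * ((({x | 0 < g x} ∩ U) \ K₁).indicator (fun x => |g x|) x +
        (({x | g x < 0} ∩ U) \ K₂).indicator (fun x => |g x|) x)) ∂μ :=
        setIntegral_mono_on (Integrable.abs hg) (iψ.add (i12.const_mul 2)) hU hpt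
    _ = ∫ x in U, g x * (f₁ - f₂) x ∂μ + 2 * ((ν (({x | 0 < g x} ∩ U) \ K₁)).toReal +
        (ν (({x | g x < 0} ∩ U) \ K₂)).toReal) := by
      rw [integral_add iψ (i12.const_mul 2), integral_const_mul, integral_add i1 i2,
        hν' (hPm.diff hK₁c.measurableSet), hν' (hNm.diff hK₂c.measurableSet)]
    _ ≤ M + 2 * (ε / 4 + ε / 4) := by
      gcongr
      · exact h _ hψ1
      · exact hlt hK₁ν
      · exact hlt hK₂ν
    _ = M + ε := by ring

/-- A dual bound of the `L¹` norm: it is enough to test with smooth functions bounded by one. -/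
theorem setIntegral_abs_le_of_forall_testFunction {U : TopologicalSpace.Opens E} {g : E → ℝ}
    (hg : IntegrableOn g U μ) {M : ℝ}
    (h : ∀ ψ : 𝓓(U, ℝ), (∀ x, |ψ x| ≤ 1) → ∫ x in U, g x * ψ x ∂μ ≤ M) :
    ∫ x in U, |g x| ∂μ ≤ M := by
  have hae := hg.aestronglyMeasurable.ae_eq_mk
  set g' := hg.aestronglyMeasurable.mk g
  have h1 : ∫ x in U, |g x| ∂μ = ∫ x in U, |g' x| ∂μ :=
    integral_congr_ae (hae.mono fun x hx => by simp only [hx])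
  rw [h1]
  refine setIntegral_abs_le_of_forall_testFunction_aux
    hg.aestronglyMeasurable.stronglyMeasurable_mk.measurable (Integrable.congr hg hae)
    fun ψ hψ => ?_
  rw [← integral_congr_ae (hae.mono fun x hx => by simp only [hx] :
    (fun x => g x * ψ x) =ᵐ[μ.restrict U] fun x => g' x * ψ x)]
  exact h ψ hψ

end Duality

/-! ### Lebesgue measure of rectangles in the plane -/

section PlaneMeasure

/-- The identification of the plane with `ℝ × ℝ`. -/
def planeEquivProd : Plane ≃ᵐ ℝ × ℝ :=
  (MeasurableEquiv.toLp 2 (Fin 2 → ℝ)).symm.trans MeasurableEquiv.finTwoArrow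

theorem planeEquivProd_apply (x : Plane) : planeEquivProd x = (x 0, x 1) := rfl

theorem planeEquivProd_symm_apply (z : ℝ × ℝ) : planeEquivProd.symm z = !₂[z.1, z.2] := by
  rw [MeasurableEquiv.symm_apply_eq, planeEquivProd_apply]
  simp

theorem measurePreserving_planeEquivProd : MeasurePreserving planeEquivProd volume volume :=
  (volume_preserving_finTwoArrow ℝ).comp (PiLp.volume_preserving_ofLp (Fin 2))

/-- The rectangle `A × B` in the plane. -/
def planeRect (A B : Set ℝ) : Set Plane := {x | x 0 ∈ A ∧ x 1 ∈ B}

theorem planeRect_eq_preimage (A B : Set ℝ) : planeRect A B = planeEquivProd ⁻¹' (A ×ˢ B) := rfl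

theorem measurableSet_planeRect {A B : Set ℝ} (hA : MeasurableSet A) (hB : MeasurableSet B) :
    MeasurableSet (planeRect A B) :=
  planeEquivProd.measurable (hA.prod hB)

theorem volume_planeRect (A B : Set ℝ) :
    volume (planeRect A B) = volume A * volume B := by
  rw [planeRect_eq_preimage, measurePreserving_planeEquivProd.measure_preimage_equiv,
    Measure.volume_eq_prod, Measure.prod_prod]

theorem unitSquare_eq_planeRect : unitSquare = planeRect (Set.Icc 0 1) (Set.Icc 0 1) := by
  ext x
  exact Fin.forall_fin_two

theorem coe_openUnitSquare : (openUnitSquare : Set Plane) =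
    planeRect (Set.Ioo 0 1) (Set.Ioo 0 1) := by
  ext x
  exact Fin.forall_fin_two

theorem volume_unitSquare : volume unitSquare = 1 := by
  rw [unitSquare_eq_planeRect, volume_planeRect]
  simp

theorem measurableSet_unitSquare : MeasurableSet unitSquare := by
  rw [unitSquare_eq_planeRect]
  exact measurableSet_planeRect measurableSet_Icc measurableSet_Icc

theorem isCompact_unitSquare : IsCompact unitSquare := by
  have : unitSquare = (EuclideanSpace.equiv (Fin 2) ℝ).toHomeomorph ⁻¹'
      (Set.univ.pi fun _ => Set.Icc (0 : ℝ) 1) := by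
    ext x
    simp only [Set.mem_preimage, Set.mem_univ_pi]
    rfl
  rw [this, Homeomorph.isCompact_preimage]
  exact isCompact_univ_pi fun _ => isCompact_Icc

theorem openUnitSquare_subset_unitSquare : (openUnitSquare : Set Plane) ⊆ unitSquare :=
  fun _ hx i => Set.Ioo_subset_Icc_self (hx i)

end PlaneMeasure

/-! ### Weak gradients of scalar functions -/

section WeakGradient

/-- `H` is a weak gradient of the scalar function `w` on the plane. -/
structure HasWeakGradient (w : Plane → ℝ) (H : Fin 2 → Plane → ℝ) : Prop where
  locallyIntegrable_fun : LocallyIntegrable w volume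
  locallyIntegrable_grad : ∀ j, LocallyIntegrable (H j) volume
  integral_eq : ∀ (j : Fin 2) (φ : 𝓓((⊤ : TopologicalSpace.Opens Plane), ℝ)),
    ∫ x, w x * testPartial φ j x = -∫ x, H j x * φ x

variable {w w' : Plane → ℝ} {H H' : Fin 2 → Plane → ℝ} {U : TopologicalSpace.Opens Plane}

theorem continuous_testPartial (φ : 𝓓(U, ℝ)) (j : Fin 2) : Continuous (testPartial φ j) :=
  (φ.contDiff.continuous_fderiv (by simp)).clm_apply continuous_const

theorem hasCompactSupport_testPartial (φ : 𝓓(U, ℝ)) (j : Fin 2) :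
    HasCompactSupport (testPartial φ j) :=
  φ.hasCompactSupport.fderiv_apply ℝ _

theorem tsupport_testPartial_subset (φ : 𝓓(U, ℝ)) (j : Fin 2) :
    tsupport (testPartial φ j) ⊆ tsupport φ :=
  tsupport_fderiv_apply_subset ℝ _

theorem integrable_mul_testFunction (hw : LocallyIntegrable w volume) (φ : 𝓓(U, ℝ)) :
    Integrable (fun x => w x * φ x) := by
  simpa [mul_comm] using
    hw.integrable_smul_left_of_hasCompactSupport φ.continuous φ.hasCompactSupport

theorem integrable_mul_testPartial (hw : LocallyIntegrable w volume) (φ : 𝓓(U, ℝ)) (j : Fin 2) :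
    Integrable (fun x => w x * testPartial φ j x) := by
  simpa [mul_comm] using hw.integrable_smul_left_of_hasCompactSupport
    (continuous_testPartial φ j) (hasCompactSupport_testPartial φ j)

theorem HasWeakGradient.sub (h : HasWeakGradient w H) (h' : HasWeakGradient w' H') :
    HasWeakGradient (fun x => w x - w' x) (fun j x => H j x - H' j x) where
  locallyIntegrable_fun := h.locallyIntegrable_fun.sub h'.locallyIntegrable_fun
  locallyIntegrable_grad j := (h.locallyIntegrable_grad j).sub (h'.locallyIntegrable_grad j)
  integral_eq j φ := by
    simp only [sub_mul]
    rw [integral_sub (integrable_mul_testPartial h.locallyIntegrable_fun φ j)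
      (integrable_mul_testPartial h'.locallyIntegrable_fun φ j),
      integral_sub (integrable_mul_testFunction (h.locallyIntegrable_grad j) φ)
      (integrable_mul_testFunction (h'.locallyIntegrable_grad j) φ),
      h.integral_eq, h'.integral_eq]
    ring

theorem HasWeakGradient.of_lipschitzWith {C : NNReal} (hw : LipschitzWith C w) :
    HasWeakGradient w (fun j x => lineDeriv ℝ w x (EuclideanSpace.single j 1)) where
  locallyIntegrable_fun := hw.continuous.locallyIntegrable
  locallyIntegrable_grad j := hw.locallyIntegrable_lineDeriv _
  integral_eq j φ := by
    obtain ⟨D, hD⟩ := (φ.contDiff.of_le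
      (by simp : (1 : WithTop ℕ∞) ≤ _)).lipschitzWith_of_hasCompactSupport φ.hasCompactSupport one_ne_zero
    rw [hw.integral_lineDeriv_mul_eq hD φ.hasCompactSupport, ← integral_neg]
    refine integral_congr_ae (.of_forall fun x => ?_)
    have hd : DifferentiableAt ℝ φ x := φ.contDiff.differentiable (by simp) x
    simp only [hd.lineDeriv_eq_fderiv, testPartial, map_neg]
    ring

/-- A weak gradient vanishes on open sets on which the function vanishes. -/
theorem HasWeakGradient.ae_eq_zero (h : HasWeakGradient w H) {S : Set Plane} (hS : IsClosed S)
    (hw : ∀ᵐ x ∂(volume : Measure Plane), x ∉ S → w x = 0) (j : Fin 2) :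
    ∀ᵐ x ∂(volume : Measure Plane), x ∉ S → H j x = 0 := by
  refine hS.isOpen_compl.ae_eq_zero_of_integral_contDiff_smul_eq_zero
    ((h.locallyIntegrable_grad j).locallyIntegrableOn _) fun φ hφ hc hs => ?_
  have := h.integral_eq j ⟨φ, hφ, hc, fun _ _ => trivial⟩
  rw [integral_eq_zero_of_ae] at this
  · rw [zero_eq_neg] at this
    rw [← this]
    exact integral_congr_ae (.of_forall fun x => mul_comm _ _)
  · filter_upwards [hw] with x hx
    by_cases hxS : x ∈ S
    · have h0 : testPartial (⟨φ, hφ, hc, fun _ _ => trivial⟩ :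
          𝓓((⊤ : TopologicalSpace.Opens Plane), ℝ)) j x = 0 := by
        by_contra hne
        exact hs (tsupport_testPartial_subset _ j (subset_tsupport _ hne)) hxS
      simp [h0]
    · simp [hx hxS]

end WeakGradient

/-! ### Interpolation inequality for functions vanishing outside the square -/

section Interpolation

/-- The open left half `(0,1/2) × (0,1)` of the unit square. -/
def leftHalf : TopologicalSpace.Opens Plane where
  carrier := planeRect (Set.Ioo 0 (1 / 2)) (Set.Ioo 0 1)
  is_open' := (isOpen_Ioo.preimage (by fun_prop : Continuous fun x : Plane => x 0)).inter
    (isOpen_Ioo.preimage (by fun_prop : Continuous fun x : Plane => x 1))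

variable {w : Plane → ℝ} {H : Fin 2 → Plane → ℝ}

theorem exists_testFunction_eq_segmentAverage {U V : TopologicalSpace.Opens Plane} {k : ℝ → ℝ}
    (hk : Continuous k) (v : Plane) (ψ : 𝓓(U, ℝ))
    (hV : ∀ r ∈ Set.Icc (0 : ℝ) 1, ∀ y ∈ (U : Set Plane), y + r • v ∈ V) :
    ∃ φ : 𝓓(V, ℝ), ⇑φ = segmentAverage k v ψ := by
  refine ⟨⟨segmentAverage k v ψ, contDiff_segmentAverage hk ψ.contDiff ψ.hasCompactSupport,
    hasCompactSupport_segmentAverage ψ.hasCompactSupport,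
    (tsupport_segmentAverage_subset ψ.hasCompactSupport).trans ?_⟩, rfl⟩
  rintro _ ⟨⟨r, y⟩, ⟨hr, hy⟩, rfl⟩
  exact hV r hr y (ψ.tsupport_subset hy)

theorem exists_testFunction_eq_sub_translate {U : TopologicalSpace.Opens Plane} (c : ℝ) (v : Plane)
    (ψ : 𝓓(U, ℝ)) :
    ∃ θ : 𝓓((⊤ : TopologicalSpace.Opens Plane), ℝ), ∀ x, θ x = c * (ψ x - ψ (x - v)) := by
  refine ⟨⟨fun x => c * (ψ x - ψ (x - v)), contDiff_const.mul
    (ψ.contDiff.sub (ψ.contDiff.comp (contDiff_id.sub contDiff_const))), ?_,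
    fun _ _ => trivial⟩, fun _ => rfl⟩
  have h1 : HasCompactSupport fun x => ψ (x - v) := by
    simpa [Function.comp_def, ← sub_eq_add_neg] using
      ψ.hasCompactSupport.comp_homeomorph (Homeomorph.addRight (-v))
  exact HasCompactSupport.mul_left (f := fun _ => c) (ψ.hasCompactSupport.sub h1)

/-- Integration against a test function, for a function which vanishes outside the unit square
and whose gradient is controlled in the second direction. -/
theorem HasWeakGradient.integral_mul_testFunction_le (h : HasWeakGradient w H)
    (hw : ∀ᵐ x ∂(volume : Measure Plane), x ∉ unitSquare → w x = 0) {M : ℝ}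
    (θ : 𝓓((⊤ : TopologicalSpace.Opens Plane), ℝ)) (hM : ∀ x, |θ x| ≤ M)
    (hθ : ∀ x, θ x ≠ 0 → 0 < x 1) :
    |∫ x, w x * θ x| ≤ M * ∫ x in unitSquare, |H 1 x| := by
  set e : Plane := EuclideanSpace.single 1 1 with he
  have hM0 : 0 ≤ M := (abs_nonneg _).trans (hM 0)
  have hk : Continuous fun _ : ℝ => (1 : ℝ) := continuous_const
  obtain ⟨Θ, hΘe⟩ := exists_testFunction_eq_segmentAverage (V := ⊤) hk e θ
    fun _ _ _ _ => trivial
  have hΘ : ∀ x, testPartial Θ 1 x = θ x - θ (x - e) := fun x => by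
    rw [testPartial, hΘe]
    exact fderiv_segmentAverage_one (θ.contDiff.of_le (by simp)) θ.hasCompactSupport x
  have hΘM : ∀ x, ‖Θ x‖ ≤ M := hΘe ▸ norm_segmentAverage_le (by simp) hM
  -- A Poincaré inequality tested with `θ`: for `x` in the square, `x - e` lies at height at most
  -- `0`, where `θ` vanishes, so `θ = ∂₁Θ` on the square.
  have h1 : ∫ x, w x * θ x = ∫ x, w x * testPartial Θ 1 x := by
    refine integral_congr_ae ?_
    filter_upwards [hw] with x hx
    by_cases hxQ : x ∈ unitSquare
    · have : θ (x - e) = 0 := by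
        by_contra hne
        have h2 := hθ _ hne
        have h3 := (hxQ 1).2
        simp [he] at h2
        linarith
      rw [hΘ, this, sub_zero]
    · simp [hx hxQ]
  have h2 : ∫ x, H 1 x * Θ x = ∫ x in unitSquare, H 1 x * Θ x := by
    rw [← integral_indicator measurableSet_unitSquare]
    refine integral_congr_ae ?_
    filter_upwards [h.ae_eq_zero isCompact_unitSquare.isClosed hw 1] with x hx
    by_cases hxQ : x ∈ unitSquare
    · simp [hxQ]
    · simp [hxQ, hx hxQ]
  rw [h1, h.integral_eq, abs_neg, h2, ← integral_const_mul]
  refine (abs_integral_le_integral_abs).trans ?_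
  have hi : IntegrableOn (H 1) unitSquare :=
    (h.locallyIntegrable_grad 1).integrableOn_isCompact isCompact_unitSquare
  refine integral_mono_of_nonneg (.of_forall fun x => abs_nonneg _) (hi.abs.const_mul M)
    (.of_forall fun x => ?_)
  simp only [abs_mul]
  rw [mul_comm]
  exact mul_le_mul_of_nonneg_right (hΘM x) (abs_nonneg _)

/-- Interpolation between the second derivative in the first direction, as a measure, and the
derivative in the second direction, tested with a smooth function. -/
theorem HasWeakGradient.integral_grad_mul_le (h : HasWeakGradient w H)
    (hw : ∀ᵐ x ∂(volume : Measure Plane), x ∉ unitSquare → w x = 0) {T : ℝ}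
    (hT : ∀ φ : 𝓓(openUnitSquare, ℝ), (∀ x, |φ x| ≤ 1) → ∫ x, H 0 x * testPartial φ 0 x ≤ T)
    {δ : ℝ} (hδ : 0 < δ) (hδ2 : δ ≤ 1 / 2) (ψ : 𝓓(leftHalf, ℝ)) (hψ : ∀ x, |ψ x| ≤ 1) :
    ∫ x, H 0 x * ψ x ≤ δ * T + 2 / δ * ∫ x in unitSquare, |H 1 x| := by
  set e : Plane := EuclideanSpace.single 0 1 with he
  have hk : Continuous fun _ : ℝ => (1 : ℝ) := continuous_const
  have hk' : Continuous fun r : ℝ => 1 - r := by fun_prop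
  have hk1 : ∀ r ∈ Set.Icc (0 : ℝ) 1, |1 - r| ≤ 1 := fun r hr => by
    rw [abs_le]; constructor <;> linarith [hr.1, hr.2]
  have hψ1 : ContDiff ℝ 1 ψ := ψ.contDiff.of_le (by simp)
  -- The average moves the support to the right by at most `δ ≤ 1/2`, so it stays in the open
  -- square: this is why the estimate is made on the left half only.
  obtain ⟨φ, hφe⟩ := exists_testFunction_eq_segmentAverage (V := openUnitSquare) hk' (δ • e) ψ (by
    rintro r hr y ⟨h0, h1⟩
    have hr0 : 0 ≤ r * δ := mul_nonneg hr.1 hδ.le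
    have hr1 : r * δ ≤ 1 / 2 := (mul_le_of_le_one_left hδ.le hr.2).trans hδ2
    rw [← SetLike.mem_coe, coe_openUnitSquare]
    constructor
    · simp only [he, PiLp.add_apply, PiLp.smul_apply, smul_eq_mul, PiLp.single_apply]
      constructor <;> norm_num <;> linarith [h0.1, h0.2]
    · simpa [he] using h1)
  obtain ⟨A, hAe⟩ := exists_testFunction_eq_segmentAverage (V := ⊤) hk (δ • e) ψ
    fun _ _ _ _ => trivial
  obtain ⟨θ, hθe⟩ := exists_testFunction_eq_sub_translate δ⁻¹ (δ • e) ψ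
  -- The splitting `ψ = δ ∂₀φ + A`: the first term is paid by the total variation, while `∂₀A` is a
  -- difference quotient of size `2/δ`.
  have hφ : ∀ x, δ * testPartial φ 0 x = ψ x - A x := by
    intro x
    have := fderiv_segmentAverage_one_sub (v := δ • e) hψ1 ψ.hasCompactSupport x
    rw [map_smul, smul_eq_mul] at this
    rwa [testPartial, hφe, hAe]
  have hA : ∀ x, testPartial A 0 x = θ x := by
    intro x
    have := fderiv_segmentAverage_one (v := δ • e) hψ1 ψ.hasCompactSupport x
    rw [map_smul, smul_eq_mul] at this
    rw [hθe, ← this, inv_mul_cancel_left₀ hδ.ne', testPartial, hAe]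
  have hθM : ∀ x, |θ x| ≤ 2 / δ := by
    intro x
    rw [hθe, abs_mul, abs_of_pos (inv_pos.2 hδ), div_eq_mul_inv, mul_comm]
    refine mul_le_mul_of_nonneg_right ?_ (inv_pos.2 hδ).le
    linarith [abs_sub (ψ x) (ψ (x - δ • e)), hψ x, hψ (x - δ • e)]
  have hpos : ∀ x, ψ x ≠ 0 → 0 < x 1 := fun x hx =>
    (show x ∈ planeRect _ _ from ψ.tsupport_subset (subset_tsupport _ hx)).2.1
  have hθ : ∀ x, θ x ≠ 0 → 0 < x 1 := by
    intro x hx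
    by_contra hneg
    have h1 : ψ x = 0 := by
      by_contra h1
      exact hneg (hpos x h1)
    have h2 : ψ (x - δ • e) = 0 := by
      by_contra h2
      have := hpos _ h2
      simp [he] at this
      exact hneg this
    apply hx
    rw [hθe, h1, h2, sub_zero, mul_zero]
  have i1 := integrable_mul_testPartial (h.locallyIntegrable_grad 0) φ 0
  have i2 := integrable_mul_testFunction (h.locallyIntegrable_grad 0) A
  have key : ∫ x, H 0 x * ψ x =
      δ * (∫ x, H 0 x * testPartial φ 0 x) + ∫ x, H 0 x * A x := by
    rw [← integral_const_mul, ← integral_add (i1.const_mul δ) i2]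
    refine integral_congr_ae (.of_forall fun x => ?_)
    simp only
    rw [show ψ x = δ * testPartial φ 0 x + A x by rw [hφ]; ring]
    ring
  have hA' : ∫ x, H 0 x * A x = -∫ x, w x * θ x := by
    rw [← neg_neg (∫ x, H 0 x * A x), ← h.integral_eq]
    simp only [hA]
  have hφ1 : ∀ x, |φ x| ≤ 1 := fun x => by
    rw [hφe]
    exact norm_segmentAverage_le (F := ℝ) (ψ := ψ) hk1 hψ x
  rw [key, hA']
  have b1 := mul_le_mul_of_nonneg_left (hT φ hφ1) hδ.le
  have b2 := neg_le_of_abs_le (h.integral_mul_testFunction_le hw θ hθM hθ)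
  linarith

/-- Interpolation inequality for the derivative in the first direction. -/
theorem HasWeakGradient.setIntegral_abs_grad_le (h : HasWeakGradient w H)
    (hw : ∀ᵐ x ∂(volume : Measure Plane), x ∉ unitSquare → w x = 0) {T : ℝ}
    (hT : ∀ φ : 𝓓(openUnitSquare, ℝ), (∀ x, |φ x| ≤ 1) → ∫ x, H 0 x * testPartial φ 0 x ≤ T)
    {δ : ℝ} (hδ : 0 < δ) (hδ2 : δ ≤ 1 / 2) :
    ∫ x in leftHalf, |H 0 x| ≤ δ * T + 2 / δ * ∫ x in unitSquare, |H 1 x| := by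
  have hsub : (leftHalf : Set Plane) ⊆ unitSquare := by
    rw [unitSquare_eq_planeRect]
    rintro x ⟨h0, h1⟩
    exact ⟨⟨h0.1.le, by linarith [h0.2]⟩, Set.Ioo_subset_Icc_self h1⟩
  refine setIntegral_abs_le_of_forall_testFunction
    (((h.locallyIntegrable_grad 0).integrableOn_isCompact isCompact_unitSquare).mono_set hsub)
    fun ψ hψ => ?_
  rw [setIntegral_eq_integral_of_forall_compl_eq_zero]
  · exact h.integral_grad_mul_le hw hT hδ hδ2 ψ hψ
  · intro x hx
    rw [image_eq_zero_of_notMem_tsupport fun hx' => hx (ψ.tsupport_subset hx'), mul_zero]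

end Interpolation

/-! ### The lower bound -/

section LowerBound

/-- The scaling argument which turns the interpolation inequality into a power law. -/
theorem exists_rpow_le_of_interpolation {p c₀ : ℝ} (hp : 1 ≤ p) (hc₀ : 0 < c₀) :
    ∃ c : ℝ, 0 < c ∧ ∀ ε ∈ Set.Ioo (0 : ℝ) 1, ∀ X : ℝ, 0 ≤ X →
      (∀ δ : ℝ, 0 < δ → δ ≤ 1 / 2 →
        c₀ / 2 ≤ X ^ (1 / p) + δ * (X / ε) + 2 / δ * X ^ (1 / p)) →
      c * ε ^ (p / (p + 1)) ≤ X := by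
  have hp0 : 0 < p := by linarith
  refine ⟨min ((c₀ / 24) ^ p) ((c₀ ^ 2 / 48) ^ (p / (p + 1))), by positivity, ?_⟩
  intro ε hε X hX h
  set s := X ^ (1 / p) with hs
  have hs0 : 0 ≤ s := by positivity
  have hsp : s ^ p = X := by
    rw [hs, ← Real.rpow_mul hX, one_div_mul_cancel hp0.ne', Real.rpow_one]
  have hεp : 0 < ε ^ (p / (p + 1)) := Real.rpow_pos_of_pos hε.1 _
  -- The balancing `δ = c₀ε/(4X)` is admissible only if `X ≥ c₀ε/2`. For smaller `X`, already `δ =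
  -- 1/2` forces `X^(1/p)` to be bounded below by a constant.
  rcases lt_or_ge X (c₀ * ε / 2) with hlt | hge
  · have h1 := h (1 / 2) (by norm_num) le_rfl
    have h2 : X / ε ≤ c₀ / 2 := by
      rw [div_le_iff₀ hε.1]; linarith
    have h3 : c₀ / 24 ≤ s := by norm_num at h1; linarith
    calc _ ≤ (c₀ / 24) ^ p * 1 := mul_le_mul (min_le_left _ _)
          (Real.rpow_le_one hε.1.le hε.2.le (by positivity)) hεp.le (by positivity)
      _ ≤ s ^ p := by rw [mul_one]; exact Real.rpow_le_rpow (by positivity) h3 hp0.le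
      _ = X := hsp
  · have hX0 : 0 < X := lt_of_lt_of_le (by have := hε.1; positivity) hge
    -- With this `δ` the surface term is exactly `c₀/4`, half of the left side.
    have hδ : 0 < c₀ * ε / (4 * X) := by have := hε.1; positivity
    have hδ2 : c₀ * ε / (4 * X) ≤ 1 / 2 := by
      rw [div_le_iff₀ (by positivity)]; linarith
    have h1 := h _ hδ hδ2
    have e1 : c₀ * ε / (4 * X) * (X / ε) = c₀ / 4 := by
      have := hε.1.ne'; field_simp
    have e2 : 2 / (c₀ * ε / (4 * X)) * s = 8 * (s * X) / (c₀ * ε) := by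
      have := hε.1.ne'; field_simp; ring
    -- The term without `δ` is absorbed in the one with `2/δ`, since `X ≥ c₀ε/2`.
    have e3 : s ≤ 4 * (s * X) / (c₀ * ε) := by
      have := hε.1
      rw [le_div_iff₀ (by positivity)]
      nlinarith [mul_le_mul_of_nonneg_left hge hs0]
    have h2 : c₀ / 4 ≤ 12 * (s * X) / (c₀ * ε) := by
      rw [e1, e2] at h1
      have : 12 * (s * X) / (c₀ * ε) = 8 * (s * X) / (c₀ * ε) + 4 * (s * X) / (c₀ * ε) := by ring
      linarith
    have h3 : c₀ ^ 2 / 48 * ε ≤ s * X := by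
      have := hε.1
      rw [le_div_iff₀ (by positivity)] at h2
      nlinarith
    have h4 : s * X = X ^ ((p + 1) / p) := by
      rw [hs, add_div, div_self hp0.ne', add_comm (1 : ℝ), Real.rpow_add hX0, Real.rpow_one]
    calc _ ≤ (c₀ ^ 2 / 48) ^ (p / (p + 1)) * ε ^ (p / (p + 1)) := by
          gcongr; exact min_le_right _ _
      _ = (c₀ ^ 2 / 48 * ε) ^ (p / (p + 1)) :=
        (Real.mul_rpow (by positivity) hε.1.le).symm
      _ ≤ (X ^ ((p + 1) / p)) ^ (p / (p + 1)) := by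
        rw [← h4]
        exact Real.rpow_le_rpow (by have := hε.1; positivity) h3 (by positivity)
      _ = X := by
        rw [← Real.rpow_mul hX, div_mul_div_cancel₀ hp0.ne', div_self (by positivity),
          Real.rpow_one]

theorem abs_entry_le_frobenius_norm (A : Mat2) (i j : Fin 2) : |A i j| ≤ ‖A‖ := by
  rw [Matrix.frobenius_norm_def, ← Real.sqrt_eq_rpow]
  refine Real.le_sqrt_of_sq_le ?_
  have h1 : ‖A i j‖ ^ (2 : ℝ) ≤ ∑ j, ‖A i j‖ ^ (2 : ℝ) :=
    Finset.single_le_sum (f := fun j => ‖A i j‖ ^ (2 : ℝ)) (fun _ _ => by positivity)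
      (Finset.mem_univ j)
  have h2 : ∑ j, ‖A i j‖ ^ (2 : ℝ) ≤ ∑ i, ∑ j, ‖A i j‖ ^ (2 : ℝ) :=
    Finset.single_le_sum (f := fun i => ∑ j, ‖A i j‖ ^ (2 : ℝ))
      (fun _ _ => Finset.sum_nonneg fun _ _ => by positivity) (Finset.mem_univ i)
  calc _ = ‖A i j‖ ^ (2 : ℝ) := by rw [Real.rpow_two, Real.norm_eq_abs]
    _ ≤ _ := h1.trans h2

theorem ofReal_min_le_infEDist_wellsK2 (A : Mat2) :
    ENNReal.ofReal (min |A 0 0 - 1| |A 0 0 + 1|) ≤ Metric.infEDist A wellsK2 := by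
  refine Metric.le_infEDist.2 fun B hB => ?_
  rw [edist_dist, dist_eq_norm]
  refine ENNReal.ofReal_le_ofReal (le_trans ?_ (abs_entry_le_frobenius_norm (A - B) 0 0))
  rcases hB with rfl | rfl
  · simp
  · simp

theorem ofReal_abs_le_infEDist_wellsK2 (A : Mat2) :
    ENNReal.ofReal |A 0 1| ≤ Metric.infEDist A wellsK2 := by
  refine Metric.le_infEDist.2 fun B hB => ?_
  rw [edist_dist, dist_eq_norm]
  refine ENNReal.ofReal_le_ofReal (le_trans ?_ (abs_entry_le_frobenius_norm (A - B) 0 1))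
  rcases hB with rfl | rfl <;> simp

/-- On the unit square, the `L¹` norm is controlled by the `Lᵖ` norm. -/
theorem setIntegral_unitSquare_le_rpow {p : ℝ} (hp : 1 ≤ p) {f : Plane → ℝ} {d : Plane → ℝ≥0∞}
    (hf : IntegrableOn f unitSquare) (hf0 : ∀ x, 0 ≤ f x) (hfd : ∀ x, ENNReal.ofReal (f x) ≤ d x)
    {X : ℝ} (hX : 0 ≤ X) (hd : ∫⁻ x in unitSquare, d x ^ p ≤ ENNReal.ofReal X) :
    ∫ x in unitSquare, f x ≤ X ^ (1 / p) := by
  have hp0 : 0 < p := by linarith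
  -- The square has measure one, so Hölder's inequality has constant one.
  have : IsProbabilityMeasure (volume.restrict unitSquare) :=
    ⟨by rw [Measure.restrict_apply_univ, volume_unitSquare]⟩
  have h1 := eLpNorm'_le_eLpNorm'_of_exponent_le (p := 1) (q := p) one_pos hp
    (volume.restrict unitSquare) hf.aestronglyMeasurable
  simp only [eLpNorm', ENNReal.rpow_one, div_one] at h1
  rw [integral_eq_lintegral_of_nonneg_ae (.of_forall hf0) hf.aestronglyMeasurable]
  refine ENNReal.toReal_le_of_le_ofReal (by positivity) ?_
  have h2 : ∀ x, ‖f x‖ₑ = ENNReal.ofReal (f x) := fun x => by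
    rw [← ofReal_norm, Real.norm_of_nonneg (hf0 x)]
  simp only [h2] at h1
  refine h1.trans ?_
  rw [← ENNReal.ofReal_rpow_of_nonneg hX (by positivity)]
  refine ENNReal.rpow_le_rpow (le_trans (lintegral_mono fun x => ?_) hd) (by positivity)
  exact ENNReal.rpow_le_rpow (hfd x) hp0.le

theorem volume_leftHalf : volume (leftHalf : Set Plane) = ENNReal.ofReal (1 / 2) := by
  change volume (planeRect _ _) = _
  rw [volume_planeRect, Real.volume_Ioo, Real.volume_Ioo]
  simp

theorem leftHalf_subset_unitSquare : (leftHalf : Set Plane) ⊆ unitSquare := by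
  rw [unitSquare_eq_planeRect]
  rintro x ⟨h0, h1⟩
  exact ⟨⟨h0.1.le, by linarith [h0.2]⟩, Set.Ioo_subset_Icc_self h1⟩

/-- Both `1` and `-1` have distance at least `1 - |μ|` from `μ`; the triangle inequality is
integrated over the left half, of area `1/2`. -/
theorem le_integral_leftHalf_add {μ : ℝ} {g : Plane → ℝ} (hg : IntegrableOn g unitSquare) :
    (1 - |μ|) / 2 ≤ (∫ x in leftHalf, |g x - μ|) +
      ∫ x in unitSquare, min |g x - 1| |g x + 1| := by
  have hfin : volume unitSquare ≠ ⊤ := by simp [volume_unitSquare]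
  have hc : ∀ c : ℝ, IntegrableOn (fun _ : Plane => c) unitSquare := fun c =>
    integrableOn_const hfin
  have i1 : IntegrableOn (fun x => |g x - μ|) unitSquare := (Integrable.sub hg (hc μ)).abs
  have i2 : IntegrableOn (fun x => min |g x - 1| |g x + 1|) unitSquare :=
    (Integrable.sub hg (hc 1)).abs.inf (Integrable.add hg (hc 1)).abs
  have hsub := leftHalf_subset_unitSquare
  have h1 : ∫ x in leftHalf, min |g x - 1| |g x + 1| ≤
      ∫ x in unitSquare, min |g x - 1| |g x + 1| :=
    setIntegral_mono_set i2 (.of_forall fun x => le_min (abs_nonneg _) (abs_nonneg _))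
      hsub.eventuallyLE
  have h2 : ∫ _ in (leftHalf : Set Plane), (1 - |μ|) ≤
      ∫ x in leftHalf, (|g x - μ| + min |g x - 1| |g x + 1|) := by
    refine setIntegral_mono ((hc _).mono_set hsub) ((i1.add i2).mono_set hsub) fun x => ?_
    simp only
    have a1 := abs_sub_abs_le_abs_sub (1 : ℝ) μ
    have a2 := abs_sub_abs_le_abs_sub (-1 : ℝ) μ
    have a3 : |1 - μ| ≤ |g x - μ| + |g x - 1| := by
      rw [show 1 - μ = (g x - μ) - (g x - 1) by ring]; exact abs_sub _ _
    have a4 : |-1 - μ| ≤ |g x - μ| + |g x + 1| := by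
      rw [show -1 - μ = (g x - μ) - (g x + 1) by ring]; exact abs_sub _ _
    rw [abs_one] at a1
    rw [abs_neg, abs_one] at a2
    rcases min_choice |g x - 1| |g x + 1| with h | h <;> rw [h] <;> linarith
  rw [integral_add (i1.mono_set hsub) (i2.mono_set hsub), setIntegral_const, Measure.real,
    volume_leftHalf, ENNReal.toReal_ofReal (by norm_num), smul_eq_mul] at h2
  linarith

/-- Used to replace `∂₀u₀` by `∂₀u₀ - μ` without changing the distributional derivative. -/
theorem integral_testPartial_eq_zero {U : TopologicalSpace.Opens Plane} (φ : 𝓓(U, ℝ))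
    (j : Fin 2) : ∫ x, testPartial φ j x = 0 := by
  have h := (HasWeakGradient.of_lipschitzWith
    (LipschitzWith.const (α := Plane) (1 : ℝ))).integral_eq j
    ⟨φ, φ.contDiff, φ.hasCompactSupport, fun _ _ => trivial⟩
  have h0 : ∀ x v : Plane, lineDeriv ℝ (fun _ : Plane => (1 : ℝ)) x v = 0 := fun x v => by
    simp [lineDeriv]
  simp only [h0, one_mul, zero_mul, integral_zero, neg_zero] at h
  exact h

/-- A test field with a single nonzero component is admissible in the supremum. -/
theorem ofReal_integral_le_totalVariation {G : Plane → Mat2} (i j k : Fin 2)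
    (φ : 𝓓(openUnitSquare, ℝ)) (hφ : ∀ x, |φ x| ≤ 1) :
    ENNReal.ofReal (∫ x, G x i j * testPartial φ k x) ≤ totalVariation openUnitSquare G := by
  let Φ : Fin 2 → Fin 2 → Fin 2 → 𝓓(openUnitSquare, ℝ) := fun i' j' k' =>
    if i' = i ∧ j' = j ∧ k' = k then φ else 0
  have hΦ : ∀ x, ∑ i, ∑ j, ∑ k, (Φ i j k x) ^ 2 ≤ 1 := by
    intro x
    have : ∑ i, ∑ j, ∑ k, (Φ i j k x) ^ 2 = (φ x) ^ 2 := by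
      fin_cases i <;> fin_cases j <;> fin_cases k <;> simp [Φ, Fin.sum_univ_two]
    rw [this, sq_le_one_iff_abs_le_one]
    exact hφ x
  have h0 : ∀ k' x, testPartial (0 : 𝓓(openUnitSquare, ℝ)) k' x = 0 := by
    intro k' x
    have : ((0 : 𝓓(openUnitSquare, ℝ)) : Plane → ℝ) = fun _ => 0 := rfl
    simp [testPartial, this]
  refine le_trans (le_of_eq ?_) (le_iSup₂ (f := fun (φ : Fin 2 → Fin 2 → Fin 2 →
    𝓓(openUnitSquare, ℝ)) (_ : ∀ x, ∑ i, ∑ j, ∑ k, (φ i j k x) ^ 2 ≤ 1) =>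
    ENNReal.ofReal (∫ x in (openUnitSquare : Set Plane),
      ∑ i, ∑ j, ∑ k, G x i j * testPartial (φ i j k) k x)) Φ hΦ)
  congr 1
  rw [← setIntegral_eq_integral_of_forall_compl_eq_zero (s := (openUnitSquare : Set Plane))]
  · refine integral_congr_ae (.of_forall fun x => ?_)
    fin_cases i <;> fin_cases j <;> fin_cases k <;> simp [Φ, Fin.sum_univ_two, h0]
  · intro x hx
    rw [image_eq_zero_of_notMem_tsupport fun hx' =>
      hx (φ.tsupport_subset (tsupport_testPartial_subset φ k hx')), mul_zero]

/-- The lower bound in the scaling law. -/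
theorem exists_ofReal_le_minEnergy {p μ : ℝ} (hp : 1 ≤ p) (hμ : |μ| < 1) :
    ∃ c : ℝ, 0 < c ∧ ∀ ε ∈ Set.Ioo (0 : ℝ) 1,
      ENNReal.ofReal (c * ε ^ (p / (p + 1))) ≤ minEnergy wellsK2 p ε !![μ, 0; 0, 0] := by
  obtain ⟨c, hc, hmain⟩ := exists_rpow_le_of_interpolation hp (sub_pos.2 hμ)
  refine ⟨c, hc, fun ε hε => le_iInf₂ fun u hu => le_iInf₂ fun G hG => ?_⟩
  by_cases htop : gradEnergy wellsK2 p ε G = ⊤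
  · rw [htop]; exact le_top
  rw [← ENNReal.ofReal_toReal htop]
  refine ENNReal.ofReal_le_ofReal ?_
  set X := (gradEnergy wellsK2 p ε G).toReal with hX
  have hX0 : 0 ≤ X := ENNReal.toReal_nonneg
  have hEX : gradEnergy wellsK2 p ε G = ENNReal.ofReal X := (ENNReal.ofReal_toReal htop).symm
  obtain ⟨-, b, hb⟩ := hu
  have hel : ∫⁻ x in unitSquare, Metric.infEDist (G x) wellsK2 ^ p ≤ ENNReal.ofReal X :=
    hEX ▸ le_self_add
  have htv : totalVariation openUnitSquare G ≤ ENNReal.ofReal (X / ε) := by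
    rw [ENNReal.ofReal_div_of_pos hε.1,
      ENNReal.le_div_iff_mul_le (.inl (ENNReal.ofReal_pos.2 hε.1).ne') (.inl ENNReal.ofReal_ne_top),
      mul_comm]
    exact hEX ▸ le_add_self
  have hG0 : HasWeakGradient (fun x => u x 0) (fun j x => G x 0 j) :=
    ⟨hG.locallyIntegrable_fun 0, hG.locallyIntegrable_grad 0, hG.integral_eq 0⟩
  -- The affine boundary datum of the first component; subtracting it gives a function that vanishes
  -- outside the square.
  let a : Plane → ℝ := fun x => μ * x 0 + b 0
  have haf : ∀ x, HasFDerivAt a (μ • (EuclideanSpace.proj 0 : Plane →L[ℝ] ℝ)) x := fun x =>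
    ((EuclideanSpace.proj 0 : Plane →L[ℝ] ℝ).hasFDerivAt.const_smul μ).add_const (b 0)
  have hal : LipschitzWith ‖μ • (EuclideanSpace.proj 0 : Plane →L[ℝ] ℝ)‖₊ a :=
    lipschitzWith_of_nnnorm_fderiv_le (𝕜 := ℝ) (fun x => (haf x).differentiableAt)
      fun x => by rw [(haf x).fderiv]
  have hW := hG0.sub (HasWeakGradient.of_lipschitzWith hal)
  have hw : ∀ᵐ x ∂(volume : Measure Plane), x ∉ unitSquare → u x 0 - a x = 0 := by
    filter_upwards [hb] with x hx hxQ
    rw [hx hxQ]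
    simp [a, Matrix.toLpLin_apply, dotProduct, Fin.sum_univ_two]
  have ha0 : ∀ x, lineDeriv ℝ a x (EuclideanSpace.single 0 1) = μ := fun x => by
    rw [(haf x).differentiableAt.lineDeriv_eq_fderiv, (haf x).fderiv]
    simp
  have ha1 : ∀ x, lineDeriv ℝ a x (EuclideanSpace.single 1 1) = 0 := fun x => by
    rw [(haf x).differentiableAt.lineDeriv_eq_fderiv, (haf x).fderiv]
    simp
  have hT : ∀ φ : 𝓓(openUnitSquare, ℝ), (∀ x, |φ x| ≤ 1) →
      ∫ x, (G x 0 0 - lineDeriv ℝ a x (EuclideanSpace.single 0 1)) * testPartial φ 0 x ≤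
        X / ε := by
    intro φ hφ
    have h1 := (ofReal_integral_le_totalVariation (G := G) 0 0 0 φ hφ).trans htv
    rw [ENNReal.ofReal_le_ofReal_iff (div_nonneg hX0 hε.1.le)] at h1
    simp only [ha0, sub_mul]
    rw [integral_sub (integrable_mul_testPartial (hG.locallyIntegrable_grad 0 0) φ 0)
      (integrable_mul_testPartial (locallyIntegrable_const μ) φ 0), integral_const_mul,
      integral_testPartial_eq_zero, mul_zero, sub_zero]
    exact h1
  have iG : ∀ j, IntegrableOn (fun x => G x 0 j) unitSquare := fun j =>
    (hG.locallyIntegrable_grad 0 j).integrableOn_isCompact isCompact_unitSquare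
  refine hmain ε hε X hX0 fun δ hδ hδ2 => ?_
  have h1 := hW.setIntegral_abs_grad_le hw hT hδ hδ2
  simp only [ha0, ha1, sub_zero] at h1
  have h2 := le_integral_leftHalf_add (μ := μ) (iG 0)
  have hc : IntegrableOn (fun _ : Plane => (1 : ℝ)) unitSquare :=
    integrableOn_const (by simp [volume_unitSquare])
  have i2 : IntegrableOn (fun x => min |G x 0 0 - 1| |G x 0 0 + 1|) unitSquare :=
    (Integrable.sub (iG 0) hc).abs.inf (Integrable.add (iG 0) hc).abs
  have h3 := setIntegral_unitSquare_le_rpow hp i2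
    (fun x => le_min (abs_nonneg _) (abs_nonneg _))
    (fun x => ofReal_min_le_infEDist_wellsK2 (G x)) hX0 hel
  have h4 := setIntegral_unitSquare_le_rpow hp (iG 1).abs (fun x => abs_nonneg _)
    (fun x => ofReal_abs_le_infEDist_wellsK2 (G x)) hX0 hel
  have h5 := mul_le_mul_of_nonneg_left h4 (by positivity : 0 ≤ 2 / δ)
  linarith

end LowerBound

/-! ### Total variation on the interval, and partitions by minimizers -/

section VariationOnTheInterval

/-- The total variation of `g` on `(0,1)`, in the distributional sense, is at most `B`. -/
structure VariationLE (g : ℝ → ℝ) (B : ℝ) : Prop where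
  integrableOn : IntegrableOn g (Set.Ioo 0 1)
  abs_integral_le : ∀ φ : ℝ → ℝ, ContDiff ℝ 1 φ → (∀ t, t ∉ Set.Ioo (0 : ℝ) 1 → φ t = 0) →
    (∀ t, |φ t| ≤ 1) → |∫ t in Set.Ioo (0 : ℝ) 1, g t * deriv φ t| ≤ B

variable {g g' : ℝ → ℝ} {B B' : ℝ}

theorem integrableOn_mul_deriv (hg : IntegrableOn g (Set.Ioo 0 1)) {φ : ℝ → ℝ}
    (hφ : ContDiff ℝ 1 φ) : IntegrableOn (fun t => g t * deriv φ t) (Set.Ioo 0 1) := by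
  have hc : Continuous (deriv φ) := hφ.continuous_deriv le_rfl
  obtain ⟨C, hC⟩ := isCompact_Icc.exists_bound_of_continuousOn (s := Set.Icc (0 : ℝ) 1)
    hc.continuousOn
  refine Integrable.mul_bdd (c := C) hg hc.aestronglyMeasurable ?_
  filter_upwards [self_mem_ae_restrict measurableSet_Ioo] with t ht
  exact hC t (Set.Ioo_subset_Icc_self ht)

theorem VariationLE.mono (h : VariationLE g B) (hB : B ≤ B') : VariationLE g B' :=
  ⟨h.integrableOn, fun φ h1 h2 h3 => (h.abs_integral_le φ h1 h2 h3).trans hB⟩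

theorem VariationLE.congr (h : VariationLE g B) (hg : ∀ᵐ t, t ∈ Set.Ioo (0 : ℝ) 1 → g t = g' t) :
    VariationLE g' B := by
  have hae : g =ᵐ[volume.restrict (Set.Ioo (0 : ℝ) 1)] g' :=
    (ae_restrict_iff' measurableSet_Ioo).2 hg
  refine ⟨Integrable.congr h.integrableOn hae, fun φ h1 h2 h3 => ?_⟩
  rw [← integral_congr_ae (hae.mono fun t ht => by simp only [ht] :
    (fun t => g t * deriv φ t) =ᵐ[volume.restrict (Set.Ioo (0 : ℝ) 1)] fun t => g' t * deriv φ t)]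
  exact h.abs_integral_le φ h1 h2 h3

theorem VariationLE.add (h : VariationLE g B) (h' : VariationLE g' B') :
    VariationLE (fun t => g t + g' t) (B + B') := by
  refine ⟨Integrable.add h.integrableOn h'.integrableOn, fun φ h1 h2 h3 => ?_⟩
  simp only [add_mul]
  rw [integral_add (integrableOn_mul_deriv h.integrableOn h1)
    (integrableOn_mul_deriv h'.integrableOn h1)]
  exact (abs_add_le _ _).trans
    (add_le_add (h.abs_integral_le φ h1 h2 h3) (h'.abs_integral_le φ h1 h2 h3))

theorem VariationLE.const_mul (h : VariationLE g B) (c : ℝ) :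
    VariationLE (fun t => c * g t) (|c| * B) := by
  refine ⟨Integrable.const_mul h.integrableOn c, fun φ h1 h2 h3 => ?_⟩
  simp only [mul_assoc]
  rw [integral_const_mul, abs_mul]
  exact mul_le_mul_of_nonneg_left (h.abs_integral_le φ h1 h2 h3) (abs_nonneg c)

theorem variationLE_const (c : ℝ) : VariationLE (fun _ => c) 0 := by
  refine ⟨integrableOn_const (by simp), fun φ h1 h2 h3 => ?_⟩
  rw [integral_const_mul, ← integral_Ioc_eq_integral_Ioo,
    ← intervalIntegral.integral_of_le zero_le_one,
    intervalIntegral.integral_deriv_eq_sub (fun t _ => h1.differentiable one_ne_zero t)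
      ((h1.continuous_deriv le_rfl).intervalIntegrable _ _), h2 0 (by simp), h2 1 (by simp)]
  simp

theorem VariationLE.sum {ι : Type*} {s : Finset ι} {G : ι → ℝ → ℝ} {b : ι → ℝ}
    (h : ∀ i ∈ s, VariationLE (G i) (b i)) :
    VariationLE (fun t => ∑ i ∈ s, G i t) (∑ i ∈ s, b i) := by
  classical
  induction s using Finset.induction_on with
  | empty => simpa using variationLE_const 0
  | insert a s ha ih =>
    simp only [Finset.sum_insert ha]
    exact (h a (Finset.mem_insert_self a s)).add
      (ih fun i hi => h i (Finset.mem_insert_of_mem hi))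

/-- Up to a null set the part of `S` in the unit interval is an interval, and the integral of `φ'`
over it is a difference of two values of `φ`. -/
theorem variationLE_indicator {S : Set ℝ} (hS : S.OrdConnected) :
    VariationLE (S.indicator 1) 2 := by
  have hSm : MeasurableSet S := hS.measurableSet
  refine ⟨Integrable.indicator (integrableOn_const (C := (1 : ℝ)) (by simp)) hSm,
    fun φ h1 h2 h3 => ?_⟩
  have e1 : ∫ t in Set.Ioo (0 : ℝ) 1, S.indicator 1 t * deriv φ t =
      ∫ t in Set.Ioo (0 : ℝ) 1 ∩ S, deriv φ t := by
    rw [← setIntegral_indicator hSm]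
    refine integral_congr_ae (.of_forall fun t => ?_)
    by_cases ht : t ∈ S <;> simp [ht]
  rw [e1]
  set T := Set.Ioo (0 : ℝ) 1 ∩ S with hT
  have hTc : T.OrdConnected := Set.ordConnected_Ioo.inter hS
  rcases T.eq_empty_or_nonempty with he | hne
  · simp [he]
  have hbb : BddBelow T := ⟨0, fun t ht => ht.1.1.le⟩
  have hba : BddAbove T := ⟨1, fun t ht => ht.1.2.le⟩
  have hab : sInf T ≤ sSup T := by
    obtain ⟨t, ht⟩ := hne
    exact (csInf_le hbb ht).trans (le_csSup hba ht)
  have hae : T =ᵐ[volume] Set.Ioc (sInf T) (sSup T) := by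
    have h1 : T ≤ᵐ[volume] Set.Icc (sInf T) (sSup T) :=
      LE.le.eventuallyLE fun t ht => ⟨csInf_le hbb ht, le_csSup hba ht⟩
    have h2 : Set.Ioo (sInf T) (sSup T) ≤ᵐ[volume] T := by
      refine LE.le.eventuallyLE fun t ht => ?_
      obtain ⟨a, ha, hat⟩ := exists_lt_of_csInf_lt hne ht.1
      obtain ⟨b, hb, htb⟩ := exists_lt_of_lt_csSup hne ht.2
      exact hTc.out ha hb ⟨hat.le, htb.le⟩
    exact (h1.trans_eq Ioc_ae_eq_Icc.symm).antisymm (Ioo_ae_eq_Ioc.symm.trans_le h2)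
  rw [setIntegral_congr_set hae, ← intervalIntegral.integral_of_le hab,
    intervalIntegral.integral_deriv_eq_sub (fun t _ => h1.differentiable one_ne_zero t)
      ((h1.continuous_deriv le_rfl).intervalIntegrable _ _)]
  linarith [abs_sub (φ (sSup T)) (φ (sInf T)), h3 (sSup T), h3 (sInf T)]

/-- If the differences of the functions of a finite family are monotone or antitone, then the
sets on which each of them is the first to attain the minimum are intervals. -/
theorem exists_ordConnected_minimizer_partition {ι : Type*} {s : Finset ι} (hs : s.Nonempty)
    {f : ι → ℝ → ℝ} {I : Set ℝ} (hI : I.OrdConnected)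
    (hf : ∀ i ∈ s, ∀ k ∈ s, MonotoneOn (fun t => f i t - f k t) I ∨
      AntitoneOn (fun t => f i t - f k t) I) :
    ∃ E : ι → Set ℝ, (∀ i ∈ s, (E i).OrdConnected) ∧ (∀ i, E i ⊆ I) ∧
      (∀ t ∈ I, ∃ i ∈ s, t ∈ E i) ∧
      (∀ t, ∀ i ∈ s, ∀ k ∈ s, t ∈ E i → t ∈ E k → i = k) ∧
      ∀ i ∈ s, ∀ t ∈ E i, ∀ k ∈ s, f i t ≤ f k t := by
  classical
  -- An arbitrary linear order breaks ties, so that the sets are disjoint.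
  let _ : LinearOrder ι := IsWellOrder.linearOrder WellOrderingRel
  let E : ι → Set ℝ := fun i =>
    {t | t ∈ I ∧ ∀ k ∈ s, f i t ≤ f k t ∧ (f i t = f k t → i ≤ k)}
  refine ⟨E, fun i hi => ⟨?_⟩, fun i t ht => ht.1, fun t ht => ?_, fun t i hi k hk h1 h2 => ?_,
    fun i hi t ht k hk => (ht.2 k hk).1⟩
  -- For each competitor `k` one endpoint suffices: the difference `f i - f k` at `t` is at most its
  -- value at `b` (monotone case) or at `a` (antitone case), and equality at `t` forces equality
  -- there, so the tie-breaking rule carries over.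
  · rintro a ⟨haI, ha⟩ b ⟨hbI, hb⟩ t ht
    have htI : t ∈ I := hI.out haI hbI ht
    refine ⟨htI, fun k hk => ?_⟩
    obtain ⟨a1, a2⟩ := ha k hk
    obtain ⟨b1, b2⟩ := hb k hk
    rcases hf i hi k hk with h | h
    · have h1 : f i t - f k t ≤ f i b - f k b := h htI hbI ht.2
      refine ⟨by linarith, fun he => b2 (by linarith)⟩
    · have h1 : f i t - f k t ≤ f i a - f k a := h haI htI ht.1
      refine ⟨by linarith, fun he => a2 (by linarith)⟩
  · obtain ⟨i₀, hi₀, hmin⟩ := s.exists_min_image (fun i => f i t) hs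
    have hne : (s.filter fun i => f i t = f i₀ t).Nonempty :=
      ⟨i₀, Finset.mem_filter.2 ⟨hi₀, rfl⟩⟩
    set i := (s.filter fun i => f i t = f i₀ t).min' hne with hi
    obtain ⟨his, hie⟩ := Finset.mem_filter.1 (Finset.min'_mem _ hne)
    rw [← hi] at his hie
    refine ⟨i, his, ht, fun k hk => ⟨hie ▸ hmin k hk, fun he => ?_⟩⟩
    exact Finset.min'_le _ _ (Finset.mem_filter.2 ⟨hk, by rw [← he, hie]⟩)
  · obtain ⟨a1, a2⟩ := h1.2 k hk
    obtain ⟨b1, b2⟩ := h2.2 i hi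
    have he := le_antisymm a1 b1
    exact le_antisymm (a2 he) (b2 he.symm)

end VariationOnTheInterval

/-! ### Variation of functions governed by a minimizing index -/

section Slices

/-- The convex, piecewise linear function with slopes `-(1 + μ)` and `1 - μ`. -/
noncomputable def cone (μ z : ℝ) : ℝ := (1 - μ) * max z 0 + (1 + μ) * max (-z) 0

/-- The linear part contributes only a constant to differences of translates, so their monotonicity
reduces to that for `max z 0`. -/
theorem cone_eq (μ z : ℝ) : cone μ z = 2 * max z 0 - (1 + μ) * z := by
  unfold cone
  rcases le_total 0 z with h | h
  · rw [max_eq_left h, max_eq_right (neg_nonpos.2 h)]; ring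
  · rw [max_eq_right h, max_eq_left (neg_nonneg.2 h)]; ring

theorem monotone_max_sub_max {a b : ℝ} (hab : a ≤ b) :
    Monotone fun t : ℝ => max (t - a) 0 - max (t - b) 0 := by
  intro t u htu
  simp only
  rcases le_total (t - a) 0 with h1 | h1 <;> rcases le_total (t - b) 0 with h2 | h2 <;>
    rcases le_total (u - a) 0 with h3 | h3 <;> rcases le_total (u - b) 0 with h4 | h4 <;>
    simp only [max_eq_left, max_eq_right, h1, h2, h3, h4] <;> linarith

/-- This is convexity of the cone. It makes the region of each cone an interval on every horizontal
line, whatever the heights of the vertices. -/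
theorem monotone_cone_sub_cone (μ : ℝ) {a b : ℝ} (hab : a ≤ b) :
    Monotone fun t => cone μ (t - a) - cone μ (t - b) := by
  intro t u htu
  have := monotone_max_sub_max hab htu
  simp only [cone_eq] at this ⊢
  linarith

theorem convexOn_cone (μ : ℝ) : ConvexOn ℝ Set.univ (cone μ) := by
  have h1 : ConvexOn ℝ Set.univ fun z : ℝ => max z 0 :=
    (convexOn_id convex_univ).sup (convexOn_const 0 convex_univ)
  have h2 : ConvexOn ℝ Set.univ fun z : ℝ => -(1 + μ) * z :=
    (LinearMap.mul ℝ ℝ (-(1 + μ))).convexOn convex_univ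
  refine ((h1.smul (zero_le_two : (0 : ℝ) ≤ 2)).add h2).congr fun z _ => ?_
  rw [cone_eq]
  simp only [Pi.add_apply, smul_eq_mul]
  ring

theorem ordConnected_cone_le (μ y τ γ : ℝ) : {t | cone μ (t - y) + τ ≤ γ}.OrdConnected := by
  refine ⟨?_⟩
  intro a ha b hb t ht
  have hc := ((convexOn_cone μ).convex_le (γ - τ)).ordConnected
  simp only [Set.mem_ofPred_eq] at ha hb ⊢
  have := hc.out (x := a - y) ⟨trivial, by linarith⟩ (y := b - y) ⟨trivial, by linarith⟩
    (show t - y ∈ _ from ⟨by linarith [ht.1], by linarith [ht.2]⟩)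
  linarith [this.2]

/-- A function which depends only on the index minimizing a family of cones. -/
theorem variationLE_of_cones {ι : Type*} {s s' : Finset ι} (hs : s.Nonempty) (hss : s' ⊆ s)
    {μ γ c : ℝ} {y τ : ι → ℝ} {a b : ι → ℝ} {g : ℝ → ℝ}
    (hactive : ∀ r ∈ Set.Ioo (0 : ℝ) 1, ∀ i ∈ s,
      (∀ k ∈ s, cone μ (r - y i) + τ i ≤ cone μ (r - y k) + τ k) → i ∈ s')
    (hg : ∀ᵐ r : ℝ, r ∈ Set.Ioo (0 : ℝ) 1 → ∀ i ∈ s,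
      (∀ k ∈ s, cone μ (r - y i) + τ i ≤ cone μ (r - y k) + τ k) →
      (cone μ (r - y i) + τ i ≤ γ → (y i < r → g r = c + a i) ∧ (r < y i → g r = c + b i)) ∧
      (γ < cone μ (r - y i) + τ i → g r = c)) :
    VariationLE g (∑ i ∈ s', 2 * (|a i| + |b i|)) := by
  classical
  obtain ⟨E, hEc, -, hEcover, hEuniq, hEmin⟩ := exists_ordConnected_minimizer_partition hs
    (f := fun i r => cone μ (r - y i) + τ i) (I := Set.univ) Set.ordConnected_univ (by
      intro i _ k _
      rcases le_total (y i) (y k) with h | h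
      · left
        intro t _ u _ htu
        have := monotone_cone_sub_cone μ h htu
        simp only at this ⊢
        linarith
      · right
        intro t _ u _ htu
        have := monotone_cone_sub_cone μ h htu
        simp only at this ⊢
        linarith)
  set S : ι → Set ℝ := fun i => {t | cone μ (t - y i) + τ i ≤ γ}
  -- The value `c` belongs to the region where the level `γ` is lower than all cones. Each active
  -- cone adds a jump on each side of its vertex, and each side is an interval.
  have hV : VariationLE (fun t => c + ∑ i ∈ s', (a i * (E i ∩ S i ∩ Set.Ioi (y i)).indicator 1 t +
      b i * (E i ∩ S i ∩ Set.Iio (y i)).indicator 1 t)) (0 + ∑ i ∈ s', (|a i| * 2 + |b i| * 2)) := by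
    refine (variationLE_const c).add (VariationLE.sum fun i hi => ?_)
    have hES : (E i ∩ S i).OrdConnected := (hEc i (hss hi)).inter (ordConnected_cone_le _ _ _ _)
    exact ((variationLE_indicator (hES.inter Set.ordConnected_Ioi)).const_mul _).add
      ((variationLE_indicator (hES.inter Set.ordConnected_Iio)).const_mul _)
  refine VariationLE.congr (hV.mono (le_of_eq ?_)) ?_
  · rw [zero_add]
    exact Finset.sum_congr rfl fun i _ => by ring
  · have hne : ∀ᵐ r : ℝ, ∀ i ∈ s, r ≠ y i :=
      (ae_ball_iff s.countable_toSet).2 fun i _ => Measure.ae_ne volume (y i)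
    filter_upwards [hg, hne] with r hr hrne hr01
    obtain ⟨i₀, hi₀, hrE⟩ := hEcover r trivial
    have hmin := hEmin i₀ hi₀ r hrE
    have hi₀' : i₀ ∈ s' := hactive r hr01 i₀ hi₀ hmin
    rw [Finset.sum_eq_single_of_mem i₀ hi₀' fun k hk hki => ?_]
    · obtain ⟨h1, h2⟩ := hr hr01 i₀ hi₀ hmin
      by_cases hS : cone μ (r - y i₀) + τ i₀ ≤ γ
      · obtain ⟨h3, h4⟩ := h1 hS
        have hmS : r ∈ E i₀ ∩ S i₀ := ⟨hrE, hS⟩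
        rcases lt_or_gt_of_ne (hrne i₀ hi₀) with hlt | hgt
        · rw [h4 hlt, Set.indicator_of_notMem (fun h => lt_asymm hlt h.2),
            Set.indicator_of_mem (s := E i₀ ∩ S i₀ ∩ Set.Iio (y i₀)) ⟨hmS, hlt⟩]
          simp
        · rw [h3 hgt, Set.indicator_of_mem (s := E i₀ ∩ S i₀ ∩ Set.Ioi (y i₀)) ⟨hmS, hgt⟩,
            Set.indicator_of_notMem (fun h => lt_asymm hgt h.2)]
          simp
      · rw [h2 (not_le.1 hS), Set.indicator_of_notMem (fun h => hS h.1.2),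
          Set.indicator_of_notMem (fun h => hS h.1.2)]
        simp
    · have hnk : r ∉ E k := fun hrk => hki (hEuniq r k (hss hk) i₀ hi₀ hrk hrE)
      rw [Set.indicator_of_notMem (fun h => hnk h.1.1),
        Set.indicator_of_notMem (fun h => hnk h.1.1)]
      simp

/-- A function which depends only on the index minimizing a family of roofs, on each half of the
unit interval. -/
theorem variationLE_of_roofs {ι : Type*} {s : Finset ι} (hs : s.Nonempty) {S σ a b : ι → ℝ}
    {g : ℝ → ℝ}
    (hg : ∀ᵐ t : ℝ, t ∈ Set.Ioo (0 : ℝ) 1 → ∀ i ∈ s,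
      (∀ k ∈ s, S i + σ i * min t (1 - t) ≤ S k + σ k * min t (1 - t)) →
      (t < 1 / 2 → g t = a i) ∧ (1 / 2 < t → g t = b i)) :
    VariationLE g (∑ i ∈ s, 2 * (|a i| + |b i|)) := by
  classical
  -- On each half the difference of two members is a constant plus a multiple of one monotone
  -- function, hence is monotone or antitone.
  have hmono : MonotoneOn (fun t : ℝ => min t (1 - t)) (Set.Iio (1 / 2)) := by
    intro t ht u hu htu
    simp only [Set.mem_Iio] at ht hu
    simp only [min_eq_left (show t ≤ 1 - t by linarith), min_eq_left (show u ≤ 1 - u by linarith)]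
    exact htu
  have hanti : AntitoneOn (fun t : ℝ => min t (1 - t)) (Set.Ioi (1 / 2)) := by
    intro t ht u hu htu
    simp only [Set.mem_Ioi] at ht hu
    simp only [min_eq_right (show 1 - t ≤ t by linarith),
      min_eq_right (show 1 - u ≤ u by linarith)]
    linarith
  obtain ⟨E, hEc, hEI, hEcover, hEuniq, hEmin⟩ := exists_ordConnected_minimizer_partition hs
    (f := fun i t => S i + σ i * min t (1 - t)) (I := Set.Iio (1 / 2)) Set.ordConnected_Iio (by
      intro i _ k _
      rcases le_total (σ k) (σ i) with h | h
      · left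
        intro t ht u hu htu
        have := mul_le_mul_of_nonneg_left (hmono ht hu htu) (sub_nonneg.2 h)
        simp only at this ⊢
        linarith
      · right
        intro t ht u hu htu
        have := mul_le_mul_of_nonneg_left (hmono ht hu htu) (sub_nonneg.2 h)
        simp only at this ⊢
        linarith)
  obtain ⟨D, hDc, hDI, hDcover, hDuniq, hDmin⟩ := exists_ordConnected_minimizer_partition hs
    (f := fun i t => S i + σ i * min t (1 - t)) (I := Set.Ioi (1 / 2)) Set.ordConnected_Ioi (by
      intro i _ k _
      rcases le_total (σ k) (σ i) with h | h
      · right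
        intro t ht u hu htu
        have := mul_le_mul_of_nonneg_left (hanti ht hu htu) (sub_nonneg.2 h)
        simp only at this ⊢
        linarith
      · left
        intro t ht u hu htu
        have := mul_le_mul_of_nonneg_left (hanti ht hu htu) (sub_nonneg.2 h)
        simp only at this ⊢
        linarith)
  have hV : VariationLE (fun t => ∑ i ∈ s, (a i * (E i).indicator 1 t + b i * (D i).indicator 1 t))
      (∑ i ∈ s, (|a i| * 2 + |b i| * 2)) :=
    VariationLE.sum fun i hi => ((variationLE_indicator (hEc i hi)).const_mul _).add
      ((variationLE_indicator (hDc i hi)).const_mul _)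
  refine VariationLE.congr (hV.mono (le_of_eq ?_)) ?_
  · exact Finset.sum_congr rfl fun i _ => by ring
  · filter_upwards [hg, Measure.ae_ne volume (1 / 2 : ℝ)] with t ht htne ht01
    rcases lt_or_gt_of_ne htne with hlt | hgt
    · obtain ⟨i₀, hi₀, htE⟩ := hEcover t hlt
      have hD0 : ∀ k, t ∉ D k := fun k hk => lt_asymm hlt (hDI k hk)
      rw [(ht ht01 i₀ hi₀ (hEmin i₀ hi₀ t htE)).1 hlt,
        Finset.sum_eq_single_of_mem i₀ hi₀ fun k hk hki => ?_]
      · simp [htE, hD0]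
      · have : t ∉ E k := fun h => hki (hEuniq t k hk i₀ hi₀ h htE)
        simp [this, hD0]
    · obtain ⟨i₀, hi₀, htD⟩ := hDcover t hgt
      have hE0 : ∀ k, t ∉ E k := fun k hk => lt_asymm hgt (hEI k hk)
      rw [(ht ht01 i₀ hi₀ (hDmin i₀ hi₀ t htD)).2 hgt,
        Finset.sum_eq_single_of_mem i₀ hi₀ fun k hk hki => ?_]
      · simp [htD, hE0]
      · have : t ∉ D k := fun h => hki (hDuniq t k hk i₀ hi₀ h htD)
        simp [this, hE0]

end Slices

/-! ### Total variation in the plane by slicing -/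

section Slicing

theorem ae_ae_of_ae_plane {P : Plane → Prop} (h : ∀ᵐ x ∂(volume : Measure Plane), P x) :
    (∀ᵐ s : ℝ, ∀ᵐ t : ℝ, P !₂[s, t]) ∧ ∀ᵐ t : ℝ, ∀ᵐ s : ℝ, P !₂[s, t] := by
  have h1 : ∀ᵐ z : ℝ × ℝ ∂(volume.prod volume), P !₂[z.1, z.2] := by
    have := (measurePreserving_planeEquivProd.symm planeEquivProd).quasiMeasurePreserving.ae h
    filter_upwards [this] with z hz
    rwa [planeEquivProd_symm_apply] at hz
  refine ⟨Measure.ae_ae_of_ae_prod h1, ?_⟩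
  have h2 : ∀ᵐ z : ℝ × ℝ ∂(volume.prod volume), P !₂[z.2, z.1] := by
    rw [← Measure.prod_swap] at h1
    exact ae_of_ae_map measurable_swap.aemeasurable h1
  exact Measure.ae_ae_of_ae_prod h2

theorem integrable_prod_of_integrableOn_openUnitSquare {f : Plane → ℝ}
    (hf : IntegrableOn f openUnitSquare) :
    Integrable (fun z : ℝ × ℝ => f !₂[z.1, z.2])
      ((volume.restrict (Set.Ioo 0 1)).prod (volume.restrict (Set.Ioo 0 1))) := by
  have hp := measurePreserving_planeEquivProd.symm planeEquivProd
  have h1 := (hp.integrableOn_comp_preimage planeEquivProd.symm.measurableEmbedding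
    (f := f) (s := openUnitSquare)).2 hf
  have h2 : planeEquivProd.symm ⁻¹' (openUnitSquare : Set Plane) =
      Set.Ioo (0 : ℝ) 1 ×ˢ Set.Ioo (0 : ℝ) 1 := by
    rw [coe_openUnitSquare, planeRect_eq_preimage, ← Set.preimage_comp]
    simp
  rw [h2, IntegrableOn, Measure.volume_eq_prod, ← Measure.prod_restrict] at h1
  simpa only [Function.comp_def, planeEquivProd_symm_apply] using h1

theorem setIntegral_openUnitSquare_eq_prod (f : Plane → ℝ) :
    ∫ x in openUnitSquare, f x = ∫ z, f !₂[z.1, z.2]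
      ∂((volume.restrict (Set.Ioo (0 : ℝ) 1)).prod (volume.restrict (Set.Ioo (0 : ℝ) 1))) := by
  have hp := measurePreserving_planeEquivProd.symm planeEquivProd
  have h1 := hp.setIntegral_preimage_emb planeEquivProd.symm.measurableEmbedding f
    openUnitSquare
  have h2 : planeEquivProd.symm ⁻¹' (openUnitSquare : Set Plane) =
      Set.Ioo (0 : ℝ) 1 ×ˢ Set.Ioo (0 : ℝ) 1 := by
    rw [coe_openUnitSquare, planeRect_eq_preimage, ← Set.preimage_comp]
    simp
  rw [← h1, h2, Measure.prod_restrict, Measure.volume_eq_prod]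
  simp only [planeEquivProd_symm_apply]

variable {g : Plane → ℝ} {B : ℝ → ℝ}

theorem contDiff_slice_zero (φ : 𝓓(openUnitSquare, ℝ)) (t : ℝ) :
    ContDiff ℝ 1 (fun s : ℝ => φ !₂[s, t]) ∧
      ∀ s, deriv (fun s : ℝ => φ !₂[s, t]) s = testPartial φ 0 !₂[s, t] := by
  have h1 : (fun s : ℝ => (!₂[s, t] : Plane)) =
      fun s => s • EuclideanSpace.single 0 (1 : ℝ) + !₂[0, t] := by
    funext s
    ext i
    fin_cases i <;> simp
  have h2 : ∀ s : ℝ, HasDerivAt (fun s : ℝ => (!₂[s, t] : Plane))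
      (EuclideanSpace.single 0 (1 : ℝ)) s := by
    intro s
    rw [h1]
    simpa using ((hasDerivAt_id s).smul_const (EuclideanSpace.single 0 (1 : ℝ) : Plane)).add_const
      (!₂[0, t] : Plane)
  refine ⟨(φ.contDiff.of_le (by simp)).comp ?_, fun s => ?_⟩
  · rw [h1]
    fun_prop
  · exact (((φ.contDiff.differentiable (by simp) _).hasFDerivAt).comp_hasDerivAt s (h2 s)).deriv

theorem contDiff_slice_one (φ : 𝓓(openUnitSquare, ℝ)) (s : ℝ) :
    ContDiff ℝ 1 (fun t : ℝ => φ !₂[s, t]) ∧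
      ∀ t, deriv (fun t : ℝ => φ !₂[s, t]) t = testPartial φ 1 !₂[s, t] := by
  have h1 : (fun t : ℝ => (!₂[s, t] : Plane)) =
      fun t => t • EuclideanSpace.single 1 (1 : ℝ) + !₂[s, 0] := by
    funext t
    ext i
    fin_cases i <;> simp
  have h2 : ∀ t : ℝ, HasDerivAt (fun t : ℝ => (!₂[s, t] : Plane))
      (EuclideanSpace.single 1 (1 : ℝ)) t := by
    intro t
    rw [h1]
    simpa using ((hasDerivAt_id t).smul_const (EuclideanSpace.single 1 (1 : ℝ) : Plane)).add_const
      (!₂[s, 0] : Plane)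
  refine ⟨(φ.contDiff.of_le (by simp)).comp ?_, fun t => ?_⟩
  · rw [h1]
    fun_prop
  · exact (((φ.contDiff.differentiable (by simp) _).hasFDerivAt).comp_hasDerivAt t (h2 t)).deriv

theorem testFunction_eq_zero_of_notMem (φ : 𝓓(openUnitSquare, ℝ)) {x : Plane}
    (hx : ¬(x 0 ∈ Set.Ioo (0 : ℝ) 1 ∧ x 1 ∈ Set.Ioo (0 : ℝ) 1)) : φ x = 0 := by
  refine image_eq_zero_of_notMem_tsupport fun h => hx ?_
  have := φ.tsupport_subset h
  rwa [coe_openUnitSquare] at this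

theorem integrableOn_mul_testPartial (hg : IntegrableOn g openUnitSquare)
    (φ : 𝓓(openUnitSquare, ℝ)) (k : Fin 2) :
    IntegrableOn (fun x => g x * testPartial φ k x) openUnitSquare := by
  obtain ⟨C, hC⟩ := (continuous_testPartial φ k).bounded_above_of_compact_support
    (hasCompactSupport_testPartial φ k)
  exact Integrable.mul_bdd (c := C) hg (continuous_testPartial φ k).aestronglyMeasurable
    (.of_forall hC)

/-- Fubini: the restriction of a test function to a line is admissible in `VariationLE`, and the
one-dimensional bounds are integrated. -/
theorem setIntegral_mul_testPartial_zero_le (hg : IntegrableOn g openUnitSquare)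
    (hB : IntegrableOn B (Set.Ioo 0 1))
    (h : ∀ᵐ t : ℝ, t ∈ Set.Ioo (0 : ℝ) 1 → VariationLE (fun s => g !₂[s, t]) (B t))
    (φ : 𝓓(openUnitSquare, ℝ)) (hφ : ∀ x, |φ x| ≤ 1) :
    ∫ x in openUnitSquare, g x * testPartial φ 0 x ≤ ∫ t in Set.Ioo 0 1, B t := by
  have hi := integrable_prod_of_integrableOn_openUnitSquare (integrableOn_mul_testPartial hg φ 0)
  rw [setIntegral_openUnitSquare_eq_prod, integral_prod_symm _ hi]
  refine integral_mono_ae hi.integral_prod_right hB ?_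
  filter_upwards [ae_restrict_of_ae h, self_mem_ae_restrict measurableSet_Ioo] with t ht ht01
  have := (ht ht01).abs_integral_le (fun s => φ !₂[s, t]) (contDiff_slice_zero φ t).1
    (fun s hs => testFunction_eq_zero_of_notMem φ fun h => hs (by simpa using h.1))
    fun s => hφ _
  simp only [(contDiff_slice_zero φ t).2] at this
  exact (le_abs_self _).trans this

theorem setIntegral_mul_testPartial_one_le (hg : IntegrableOn g openUnitSquare)
    (hB : IntegrableOn B (Set.Ioo 0 1))
    (h : ∀ᵐ s : ℝ, s ∈ Set.Ioo (0 : ℝ) 1 → VariationLE (fun t => g !₂[s, t]) (B s))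
    (φ : 𝓓(openUnitSquare, ℝ)) (hφ : ∀ x, |φ x| ≤ 1) :
    ∫ x in openUnitSquare, g x * testPartial φ 1 x ≤ ∫ s in Set.Ioo 0 1, B s := by
  have hi := integrable_prod_of_integrableOn_openUnitSquare (integrableOn_mul_testPartial hg φ 1)
  rw [setIntegral_openUnitSquare_eq_prod, integral_prod _ hi]
  refine integral_mono_ae hi.integral_prod_left hB ?_
  filter_upwards [ae_restrict_of_ae h, self_mem_ae_restrict measurableSet_Ioo] with s hs hs01
  have := (hs hs01).abs_integral_le (fun t => φ !₂[s, t]) (contDiff_slice_one φ s).1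
    (fun t ht => testFunction_eq_zero_of_notMem φ fun h => ht (by simpa using h.2))
    fun t => hφ _
  simp only [(contDiff_slice_one φ s).2] at this
  exact (le_abs_self _).trans this

/-- A bound of the total variation of a matrix field with only one nonzero row, by bounds on
slices. -/
theorem totalVariation_le_of_slices {G : Plane → Mat2} {B D : ℝ → ℝ}
    (hG1 : ∀ x j, G x 1 j = 0) (hG : ∀ j, IntegrableOn (fun x => G x 0 j) openUnitSquare)
    (hB : IntegrableOn B (Set.Ioo 0 1)) (hD : IntegrableOn D (Set.Ioo 0 1))
    (h0 : ∀ j, ∀ᵐ t : ℝ, t ∈ Set.Ioo (0 : ℝ) 1 → VariationLE (fun s => G !₂[s, t] 0 j) (B t))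
    (h1 : ∀ j, ∀ᵐ s : ℝ, s ∈ Set.Ioo (0 : ℝ) 1 → VariationLE (fun t => G !₂[s, t] 0 j) (D s)) :
    totalVariation openUnitSquare G ≤
      ENNReal.ofReal (2 * ((∫ t in Set.Ioo 0 1, B t) + ∫ s in Set.Ioo 0 1, D s)) := by
  refine iSup₂_le fun φ hφ => ENNReal.ofReal_le_ofReal ?_
  have hφ1 : ∀ i j k x, |φ i j k x| ≤ 1 := by
    intro i j k x
    rw [← sq_le_one_iff_abs_le_one]
    refine le_trans ?_ (hφ x)
    calc (φ i j k x) ^ 2 ≤ ∑ k, (φ i j k x) ^ 2 :=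
          Finset.single_le_sum (f := fun k => (φ i j k x) ^ 2) (fun _ _ => sq_nonneg _)
            (Finset.mem_univ k)
      _ ≤ ∑ j, ∑ k, (φ i j k x) ^ 2 :=
          Finset.single_le_sum (f := fun j => ∑ k, (φ i j k x) ^ 2)
            (fun _ _ => Finset.sum_nonneg fun _ _ => sq_nonneg _) (Finset.mem_univ j)
      _ ≤ _ := Finset.single_le_sum (f := fun i => ∑ j, ∑ k, (φ i j k x) ^ 2)
            (fun _ _ => Finset.sum_nonneg fun _ _ => Finset.sum_nonneg fun _ _ => sq_nonneg _)
            (Finset.mem_univ i)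
  have hi : ∀ j k, IntegrableOn (fun x => G x 0 j * testPartial (φ 0 j k) k x) openUnitSquare :=
    fun j k => integrableOn_mul_testPartial (hG j) _ k
  have b0 : ∀ j, ∫ x in openUnitSquare, G x 0 j * testPartial (φ 0 j 0) 0 x ≤
      ∫ t in Set.Ioo 0 1, B t := fun j =>
    setIntegral_mul_testPartial_zero_le (hG j) hB (h0 j) _ (hφ1 0 j 0)
  have b1 : ∀ j, ∫ x in openUnitSquare, G x 0 j * testPartial (φ 0 j 1) 1 x ≤
      ∫ s in Set.Ioo 0 1, D s := fun j =>
    setIntegral_mul_testPartial_one_le (hG j) hD (h1 j) _ (hφ1 0 j 1)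
  -- Two entries and two directions remain, which gives the factor `2` in front of both integrals.
  simp only [Fin.sum_univ_two, hG1, zero_mul, add_zero]
  have hs : ∀ j, IntegrableOn (fun x => G x 0 j * testPartial (φ 0 j 0) 0 x +
      G x 0 j * testPartial (φ 0 j 1) 1 x) openUnitSquare := fun j => (hi j 0).add (hi j 1)
  rw [integral_add (hs 0) (hs 1),
    integral_add (hi 0 0) (hi 0 1), integral_add (hi 1 0) (hi 1 1)]
  linarith [b0 0, b0 1, b1 0, b1 1]

end Slicing

/-! ### The branching construction as a minimum of cones -/

section Branching

theorem cone_nonneg {μ : ℝ} (hμ : |μ| < 1) (z : ℝ) : 0 ≤ cone μ z := by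
  obtain ⟨h1, h2⟩ := abs_lt.1 hμ
  have := le_max_right z 0
  have := le_max_right (-z) 0
  unfold cone
  have : 0 ≤ 1 - μ := by linarith
  have : 0 ≤ 1 + μ := by linarith
  positivity

theorem cone_of_nonneg (μ : ℝ) {z : ℝ} (hz : 0 ≤ z) : cone μ z = (1 - μ) * z := by
  rw [cone_eq, max_eq_left hz]; ring

theorem cone_of_nonpos (μ : ℝ) {z : ℝ} (hz : z ≤ 0) : cone μ z = -(1 + μ) * z := by
  rw [cone_eq, max_eq_right hz]; ring

theorem cone_le {μ : ℝ} (hμ : |μ| < 1) (z : ℝ) : cone μ z ≤ 2 * |z| := by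
  obtain ⟨h1, h2⟩ := abs_lt.1 hμ
  rcases le_total 0 z with h | h
  · rw [cone_of_nonneg μ h, abs_of_nonneg h]; nlinarith
  · rw [cone_of_nonpos μ h, abs_of_nonpos h]; nlinarith

theorem cone_eq_max (μ z : ℝ) : cone μ z = max ((1 - μ) * z) (-(1 + μ) * z) := by
  rcases le_total 0 z with h | h
  · rw [cone_of_nonneg μ h, max_eq_left (by linarith)]
  · rw [cone_of_nonpos μ h, max_eq_right (by linarith)]

theorem lipschitzWith_cone {μ : ℝ} (hμ : |μ| < 1) : LipschitzWith 2 (cone μ) := by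
  obtain ⟨h1, h2⟩ := abs_lt.1 hμ
  have hl : ∀ c : ℝ, |c| ≤ 2 → LipschitzWith 2 fun z : ℝ => c * z := fun c hc =>
    LipschitzWith.of_dist_le_mul fun x y => by
      rw [Real.dist_eq, Real.dist_eq, ← mul_sub, abs_mul]
      exact mul_le_mul_of_nonneg_right hc (abs_nonneg _)
  have := (hl (1 - μ) (by rw [abs_le]; constructor <;> linarith)).max
    (hl (-(1 + μ)) (by rw [abs_le]; constructor <;> linarith))
  rw [max_self] at this
  rwa [show cone μ = fun z => max ((1 - μ) * z) (-(1 + μ) * z) from funext (cone_eq_max μ)]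

theorem hasDerivAt_cone_of_pos (μ : ℝ) {z : ℝ} (hz : 0 < z) :
    HasDerivAt (cone μ) (1 - μ) z := by
  have h : HasDerivAt (fun z => (1 - μ) * z) (1 - μ) z := by
    simpa using (hasDerivAt_id z).const_mul (1 - μ)
  refine h.congr_of_eventuallyEq ?_
  filter_upwards [lt_mem_nhds hz] with y hy using cone_of_nonneg μ hy.le

theorem hasDerivAt_cone_of_neg (μ : ℝ) {z : ℝ} (hz : z < 0) :
    HasDerivAt (cone μ) (-(1 + μ)) z := by
  have h : HasDerivAt (fun z => -(1 + μ) * z) (-(1 + μ)) z := by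
    simpa using (hasDerivAt_id z).const_mul (-(1 + μ))
  refine h.congr_of_eventuallyEq ?_
  filter_upwards [gt_mem_nhds hz] with y hy using cone_of_nonpos μ hy.le

/-- The distance to the complement of the unit interval. -/
noncomputable def roof (t : ℝ) : ℝ := max 0 (min t (1 - t))

theorem roof_nonneg (t : ℝ) : 0 ≤ roof t := le_max_left _ _

theorem roof_of_mem {t : ℝ} (ht : t ∈ Set.Icc (0 : ℝ) 1) : roof t = min t (1 - t) :=
  max_eq_right (le_min ht.1 (by linarith [ht.2]))

theorem roof_of_notMem {t : ℝ} (ht : t ∉ Set.Icc (0 : ℝ) 1) : roof t = 0 := by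
  refine max_eq_left ?_
  by_contra h
  obtain ⟨h1, h2⟩ := lt_min_iff.1 (not_le.1 h)
  exact ht ⟨h1.le, by linarith⟩

theorem roof_le_half (t : ℝ) : roof t ≤ 1 / 2 := by
  refine max_le (by norm_num) ?_
  rcases le_total t (1 / 2) with h | h
  · exact (min_le_left _ _).trans h
  · exact (min_le_right _ _).trans (by linarith)

theorem lipschitzWith_roof : LipschitzWith 1 roof := by
  have h : LipschitzWith 1 fun t : ℝ => 1 - t :=
    LipschitzWith.of_dist_le_mul fun x y => by
      rw [NNReal.coe_one, one_mul, Real.dist_eq, Real.dist_eq, sub_sub_sub_cancel_left, abs_sub_comm]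
  have := (LipschitzWith.id.min h).const_max (0 : ℝ)
  rwa [max_self] at this

theorem hasDerivAt_roof_of_lt {t : ℝ} (h0 : 0 < t) (h1 : t < 1 / 2) : HasDerivAt roof 1 t := by
  refine (hasDerivAt_id t).congr_of_eventuallyEq ?_
  filter_upwards [lt_mem_nhds h0, gt_mem_nhds h1] with y hy0 hy1
  rw [roof_of_mem ⟨hy0.le, by linarith⟩, min_eq_left (by linarith), id]

theorem hasDerivAt_roof_of_gt {t : ℝ} (h0 : 1 / 2 < t) (h1 : t < 1) : HasDerivAt roof (-1) t := by
  refine ((hasDerivAt_id t).const_sub 1).congr_of_eventuallyEq ?_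
  filter_upwards [lt_mem_nhds h0, gt_mem_nhds h1] with y hy0 hy1
  rw [roof_of_mem ⟨by linarith, hy1.le⟩, min_eq_right (by linarith), id]

/-- The index set of the cones used in the branching construction with `J + 1` generations. -/
def branchIndex (N J : ℕ) : Finset (Σ _ : ℕ, ℕ) :=
  (Finset.range (J + 1)).sigma fun j => Finset.range (N * 2 ^ j + 1)

/-- The vertex of a cone. -/
noncomputable def node (N : ℕ) (i : Σ _ : ℕ, ℕ) : ℝ := i.2 / (N * 2 ^ i.1)

/-- The slope in the second direction of the cones of the generation `j`. -/
noncomputable def branchSlope (ρ : ℝ) (N j : ℕ) : ℝ := (ρ ^ j - 1) / N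

theorem mem_branchIndex {N J : ℕ} {i : Σ _ : ℕ, ℕ} :
    i ∈ branchIndex N J ↔ i.1 ≤ J ∧ i.2 ≤ N * 2 ^ i.1 := by
  simp [branchIndex]

theorem branchIndex_nonempty (N J : ℕ) : (branchIndex N J).Nonempty :=
  ⟨⟨0, 0⟩, mem_branchIndex.2 ⟨Nat.zero_le _, Nat.zero_le _⟩⟩

/-- One of the functions of which the branching construction is the minimum. -/
noncomputable def branchCone (μ ρ : ℝ) (N : ℕ) (i : Σ _ : ℕ, ℕ) (x : Plane) : ℝ :=
  cone μ (x 0 - node N i) + branchSlope ρ N i.1 * roof (x 1)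

/-- The branching construction: a minimum of cones whose vertices become denser towards the
horizontal sides of the unit square. -/
noncomputable def branching (μ ρ : ℝ) (N J : ℕ) (x : Plane) : ℝ :=
  min (min ((branchIndex N J).inf' (branchIndex_nonempty N J) fun i => branchCone μ ρ N i x)
    (2 * roof (x 1))) (2 * roof (x 0))

variable {μ ρ : ℝ} {N J : ℕ}

theorem branchSlope_nonneg (hρ : 1 < ρ) (j : ℕ) : 0 ≤ branchSlope ρ N j :=
  div_nonneg (sub_nonneg.2 (one_le_pow₀ hρ.le)) (Nat.cast_nonneg N)

theorem branchSlope_le (j : ℕ) : branchSlope ρ N j ≤ ρ ^ j / N :=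
  div_le_div_of_nonneg_right (by linarith) (Nat.cast_nonneg N)

/-- The condition `ρ ^ J ≤ N` limits the number of generations: it keeps all slopes below the slope
`2` of the cap and makes the Lipschitz constant independent of `N`. -/
theorem branchSlope_le_one (hρ : 1 < ρ) (hJ : ρ ^ J ≤ N) {j : ℕ} (hj : j ≤ J) :
    branchSlope ρ N j ≤ 1 := by
  have h1 : ρ ^ j ≤ ρ ^ J := pow_le_pow_right₀ hρ.le hj
  exact (branchSlope_le j).trans (div_le_one_of_le₀ (h1.trans hJ) (Nat.cast_nonneg N))

theorem branchCone_nonneg (hμ : |μ| < 1) (hρ : 1 < ρ) (i : Σ _ : ℕ, ℕ) (x : Plane) :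
    0 ≤ branchCone μ ρ N i x :=
  add_nonneg (cone_nonneg hμ _) (mul_nonneg (branchSlope_nonneg hρ _) (roof_nonneg _))

theorem branching_le_branchCone {i : Σ _ : ℕ, ℕ} (hi : i ∈ branchIndex N J) (x : Plane) :
    branching μ ρ N J x ≤ branchCone μ ρ N i x :=
  (min_le_left _ _).trans ((min_le_left _ _).trans (Finset.inf'_le _ hi))

theorem branching_le_roof (x : Plane) : branching μ ρ N J x ≤ 2 * roof (x 1) :=
  (min_le_left _ _).trans (min_le_right _ _)

theorem branching_nonneg (hμ : |μ| < 1) (hρ : 1 < ρ) (x : Plane) : 0 ≤ branching μ ρ N J x :=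
  le_min (le_min (Finset.le_inf' _ _ fun i _ => branchCone_nonneg hμ hρ i x)
    (mul_nonneg zero_le_two (roof_nonneg _))) (mul_nonneg zero_le_two (roof_nonneg _))

theorem branching_eq_zero (hμ : |μ| < 1) (hρ : 1 < ρ) {x : Plane} (hx : x ∉ unitSquare) :
    branching μ ρ N J x = 0 := by
  refine le_antisymm ?_ (branching_nonneg hμ hρ x)
  rw [unitSquare_eq_planeRect] at hx
  by_cases h0 : x 0 ∈ Set.Icc (0 : ℝ) 1
  · have h1 : x 1 ∉ Set.Icc (0 : ℝ) 1 := fun h1 => hx ⟨h0, h1⟩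
    refine (branching_le_roof x).trans ?_
    rw [roof_of_notMem h1, mul_zero]
  · refine (min_le_right _ _).trans ?_
    rw [roof_of_notMem h0, mul_zero]

theorem lipschitzWith_coord (i : Fin 2) : LipschitzWith 1 fun x : Plane => x i := by
  refine LipschitzWith.of_dist_le_mul fun x y => ?_
  rw [NNReal.coe_one, one_mul, Real.dist_eq, dist_eq_norm, ← Real.norm_eq_abs]
  exact PiLp.norm_apply_le (x - y) i

theorem lipschitzWith_branchCone (hμ : |μ| < 1) (hρ : 1 < ρ) (hJ : ρ ^ J ≤ N) {i : Σ _ : ℕ, ℕ}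
    (hi : i ∈ branchIndex N J) : LipschitzWith 3 (branchCone μ ρ N i) := by
  refine LipschitzWith.of_dist_le_mul fun x y => ?_
  have h1 := (lipschitzWith_cone hμ).dist_le_mul (x 0 - node N i) (y 0 - node N i)
  have h2 := lipschitzWith_roof.dist_le_mul (x 1) (y 1)
  have h3 := (lipschitzWith_coord 0).dist_le_mul x y
  have h4 := (lipschitzWith_coord 1).dist_le_mul x y
  have h5 := branchSlope_nonneg (N := N) hρ i.1
  have h6 := branchSlope_le_one hρ hJ (mem_branchIndex.1 hi).1
  simp only [Real.dist_eq, NNReal.coe_one, NNReal.coe_ofNat, one_mul, sub_sub_sub_cancel_right]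
    at h1 h2 h3 h4 ⊢
  have h7 : |branchSlope ρ N i.1 * (roof (x 1) - roof (y 1))| ≤ |roof (x 1) - roof (y 1)| := by
    rw [abs_mul, abs_of_nonneg h5]
    exact mul_le_of_le_one_left (abs_nonneg _) h6
  unfold branchCone
  have h8 := abs_add_le (cone μ (x 0 - node N i) - cone μ (y 0 - node N i))
    (branchSlope ρ N i.1 * (roof (x 1) - roof (y 1)))
  rw [show cone μ (x 0 - node N i) + branchSlope ρ N i.1 * roof (x 1) -
    (cone μ (y 0 - node N i) + branchSlope ρ N i.1 * roof (y 1)) =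
    cone μ (x 0 - node N i) - cone μ (y 0 - node N i) +
    branchSlope ρ N i.1 * (roof (x 1) - roof (y 1)) by ring]
  linarith

theorem lipschitzWith_branching (hμ : |μ| < 1) (hρ : 1 < ρ) (hJ : ρ ^ J ≤ N) :
    LipschitzWith 3 (branching μ ρ N J) := by
  have h1 : LipschitzWith 3 fun x : Plane =>
      (branchIndex N J).inf' (branchIndex_nonempty N J) fun i => branchCone μ ρ N i x := by
    have := Finset.inf'_induction (branchIndex_nonempty N J) (branchCone μ ρ N)
      (p := LipschitzWith 3)
      (fun f hf g hg => by
        have := LipschitzWith.min hf hg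
        rw [max_self] at this
        exact this)
      fun i hi => lipschitzWith_branchCone hμ hρ hJ hi
    convert this using 1
    funext x
    rw [Finset.inf'_apply]
  have h2 : ∀ i : Fin 2, LipschitzWith 3 fun x : Plane => 2 * roof (x i) := by
    intro i
    refine LipschitzWith.of_dist_le_mul fun x y => ?_
    have h2 := lipschitzWith_roof.dist_le_mul (x i) (y i)
    have h3 := (lipschitzWith_coord i).dist_le_mul x y
    have h4 : (0 : ℝ) ≤ dist x y := dist_nonneg
    simp only [Real.dist_eq, NNReal.coe_one, NNReal.coe_ofNat, one_mul] at h2 h3 ⊢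
    rw [← mul_sub, abs_mul, abs_two]
    linarith
  have := (h1.min (h2 1)).min (h2 0)
  simp only [max_self] at this
  exact this

/-- In the unit square, the truncation at the vertical sides is not active. -/
theorem branching_eq_of_mem (hμ : |μ| < 1) (hN : 0 < N) {x : Plane}
    (hx : x 0 ∈ Set.Icc (0 : ℝ) 1) :
    branching μ ρ N J x =
      min ((branchIndex N J).inf' (branchIndex_nonempty N J) fun i => branchCone μ ρ N i x)
        (2 * roof (x 1)) := by
  obtain ⟨h1, h2⟩ := abs_lt.1 hμ
  refine min_eq_left ((min_le_left _ _).trans ?_)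
  -- Generation `0` is not raised at all, and it has vertices at both `0` and `1`; these two cones
  -- lie below `2 * roof (x 0)`.
  have hs : branchSlope ρ N 0 = 0 := by simp [branchSlope]
  rcases le_total (x 0) (1 / 2) with h | h
  · refine (Finset.inf'_le _ (mem_branchIndex.2
      (⟨Nat.zero_le _, Nat.zero_le _⟩ : (⟨0, 0⟩ : Σ _ : ℕ, ℕ).1 ≤ J ∧ _))).trans ?_
    rw [branchCone, hs, roof_of_mem hx, min_eq_left (by linarith), cone_of_nonneg μ (by
      simpa [node] using hx.1)]
    simp only [node, Nat.cast_zero, zero_div, sub_zero, zero_mul, add_zero]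
    nlinarith [hx.1]
  · refine (Finset.inf'_le _ (mem_branchIndex.2
      (⟨Nat.zero_le _, by simp⟩ : (⟨0, N⟩ : Σ _ : ℕ, ℕ).1 ≤ J ∧ _))).trans ?_
    have hn : node N ⟨0, N⟩ = 1 := by
      have : (N : ℝ) ≠ 0 := by positivity
      simp [node, this]
    rw [branchCone, hs, roof_of_mem hx, min_eq_right (by linarith), hn,
      cone_of_nonpos μ (by linarith [hx.2])]
    nlinarith [hx.2]

/-- Every point of the unit square is a touching point of one of the functions of the minimum. -/
theorem branching_eq_branchCone (hμ : |μ| < 1) (hN : 0 < N) {x : Plane}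
    (hx : x 0 ∈ Set.Icc (0 : ℝ) 1) {i : Σ _ : ℕ, ℕ} (hi : i ∈ branchIndex N J)
    (hmin : ∀ k ∈ branchIndex N J, branchCone μ ρ N i x ≤ branchCone μ ρ N k x)
    (hle : branchCone μ ρ N i x ≤ 2 * roof (x 1)) :
    branching μ ρ N J x = branchCone μ ρ N i x := by
  refine le_antisymm (branching_le_branchCone hi x) ?_
  rw [branching_eq_of_mem hμ hN hx]
  exact le_min (Finset.le_inf' _ _ hmin) hle

theorem branching_eq_roof (hμ : |μ| < 1) (hN : 0 < N) {x : Plane}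
    (hx : x 0 ∈ Set.Icc (0 : ℝ) 1)
    (hmin : ∀ k ∈ branchIndex N J, 2 * roof (x 1) ≤ branchCone μ ρ N k x) :
    branching μ ρ N J x = 2 * roof (x 1) := by
  refine le_antisymm (branching_le_roof x) ?_
  rw [branching_eq_of_mem hμ hN hx]
  exact le_min (Finset.le_inf' _ _ hmin) le_rfl

/-- There is a vertex of generation `j` near every point of the unit interval. -/
theorem exists_branchCone_le (hμ : |μ| < 1) (hN : 0 < N) {x : Plane}
    (hx : x 0 ∈ Set.Icc (0 : ℝ) 1) {j : ℕ} (hj : j ≤ J) :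
    ∃ i ∈ branchIndex N J, i.1 = j ∧
      branchCone μ ρ N i x ≤ 2 / (N * 2 ^ j) + branchSlope ρ N j * roof (x 1) := by
  have hn : (0 : ℝ) < N * 2 ^ j := by positivity
  have h0 : 0 ≤ x 0 * (N * 2 ^ j) := mul_nonneg hx.1 hn.le
  -- The vertex just to the left, at distance at most the spacing `1/(N 2^j)`.
  refine ⟨⟨j, ⌊x 0 * (N * 2 ^ j)⌋₊⟩, mem_branchIndex.2 ⟨hj, ?_⟩, rfl, ?_⟩
  · refine Nat.floor_le_of_le ?_
    push_cast
    exact mul_le_of_le_one_left hn.le hx.2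
  · refine add_le_add ((cone_le hμ _).trans ?_) le_rfl
    have h1 := Nat.floor_le h0
    have h2 := Nat.lt_floor_add_one (x 0 * (N * 2 ^ j))
    have h3 : |x 0 - node N ⟨j, ⌊x 0 * (N * 2 ^ j)⌋₊⟩| ≤ 1 / (N * 2 ^ j) := by
      rw [node, abs_le]
      constructor
      · have : (⌊x 0 * (N * 2 ^ j)⌋₊ : ℝ) / (N * 2 ^ j) ≤ x 0 := by rwa [div_le_iff₀ hn]
        have : (0 : ℝ) ≤ 1 / (N * 2 ^ j) := by positivity
        linarith
      · rw [sub_le_iff_le_add, ← add_div, le_div_iff₀ hn]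
        linarith
    calc _ ≤ 2 * (1 / (N * 2 ^ j : ℝ)) := mul_le_mul_of_nonneg_left h3 zero_le_two
      _ = _ := by ring

/-- The depth down to which the generation `j` is visible. -/
noncomputable def branchDepth (ρ : ℝ) (j : ℕ) : ℝ := 4 * ρ / (ρ - 1) / (2 * ρ) ^ j

/-- A cone of the generation `j` is minimal only near the horizontal sides. -/
theorem roof_le_branchDepth (hμ : |μ| < 1) (hρ : 1 < ρ) (hN : 0 < N) {x : Plane}
    (hx : x 0 ∈ Set.Icc (0 : ℝ) 1) {i : Σ _ : ℕ, ℕ} (hi : i ∈ branchIndex N J)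
    (hmin : ∀ k ∈ branchIndex N J, branchCone μ ρ N i x ≤ branchCone μ ρ N k x) :
    roof (x 1) ≤ branchDepth ρ i.1 := by
  obtain ⟨j, k⟩ := i
  have hρ1 : 0 < ρ - 1 := by linarith
  have hρ0 : 0 < ρ := by linarith
  have hN' : (0 : ℝ) < N := by exact_mod_cast hN
  cases j with
  | zero =>
    -- Generation `0` is visible everywhere: its depth `4ρ/(ρ-1)` exceeds `1/2`.
    refine (roof_le_half _).trans ?_
    simp only [branchDepth, pow_zero, div_one]
    rw [le_div_iff₀ hρ1]
    linarith
  | succ j =>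
    -- Comparison with a nearby cone of the previous generation: the gain `(σ_{j+1} - σ_j) r` in
    -- height cannot exceed `2/(N 2^j)`.
    obtain ⟨l, hl, rfl, hle⟩ := exists_branchCone_le (ρ := ρ) hμ hN hx
      (Nat.le_of_succ_le (mem_branchIndex.1 hi).1)
    have h1 := (hmin l hl).trans hle
    have h2 : branchSlope ρ N (l.1 + 1) * roof (x 1) ≤ branchCone μ ρ N ⟨l.1 + 1, k⟩ x :=
      le_add_of_nonneg_left (cone_nonneg hμ _)
    have h3 : (branchSlope ρ N (l.1 + 1) - branchSlope ρ N l.1) * roof (x 1) ≤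
        2 / (N * 2 ^ l.1) := by
      rw [sub_mul]; linarith
    have h4 : branchSlope ρ N (l.1 + 1) - branchSlope ρ N l.1 = ρ ^ l.1 * (ρ - 1) / N := by
      rw [branchSlope, branchSlope, ← sub_div, pow_succ]
      congr 1
      ring
    have h5 : 0 < ρ ^ l.1 * (ρ - 1) / N := by positivity
    rw [h4, mul_comm, ← le_div_iff₀ h5] at h3
    refine h3.trans (le_of_eq ?_)
    rw [branchDepth]
    field_simp
    ring

/-- A nearby cone of the last generation has height at most `2/(N 2^J) + r`, which is below the cap
`2r` as soon as `r` exceeds `2/(N 2^J)`. The cap is therefore confined to a thin layer. -/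
theorem roof_le_of_lt_branchCone (hμ : |μ| < 1) (hρ : 1 < ρ) (hN : 0 < N) (hJ : ρ ^ J ≤ N)
    {x : Plane} (hx : x 0 ∈ Set.Icc (0 : ℝ) 1)
    (hmin : ∀ k ∈ branchIndex N J, 2 * roof (x 1) ≤ branchCone μ ρ N k x) :
    roof (x 1) ≤ 2 / (N * 2 ^ J) := by
  obtain ⟨l, hl, -, hle⟩ := exists_branchCone_le (ρ := ρ) hμ hN hx le_rfl
  have h1 := (hmin l hl).trans hle
  have h2 := mul_le_of_le_one_left (roof_nonneg (x 1)) (branchSlope_le_one hρ hJ (le_refl J))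
  linarith

end Branching

/-! ### The gradient of the branching construction -/

section BranchingGradient

/-- Fermat's rule: along the line, `h - f` has a minimum at `x`. -/
theorem lineDeriv_eq_of_le {E : Type*} [NormedAddCommGroup E] [NormedSpace ℝ E] {f h : E → ℝ}
    {x v : E} {h' : ℝ} (hf : LineDifferentiableAt ℝ f x v) (hh : HasLineDerivAt ℝ h h' x v)
    (hle : ∀ y, f y ≤ h y) (heq : f x = h x) : lineDeriv ℝ f x v = h' := by
  have hd : HasDerivAt (fun t : ℝ => h (x + t • v) - f (x + t • v)) (h' - lineDeriv ℝ f x v) 0 :=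
    HasDerivAt.fun_sub hh hf.hasLineDerivAt
  have hmin : IsLocalMin (fun t : ℝ => h (x + t • v) - f (x + t • v)) 0 :=
    .of_forall fun t => by simp [heq, hle]
  linarith [hmin.hasDerivAt_eq_zero hd]

theorem ae_coord_ne (i : Fin 2) (c : ℝ) : ∀ᵐ x ∂(volume : Measure Plane), x i ≠ c := by
  have h : ∀ S : Set Plane, volume S = 0 → S = {x | x i = c} →
      ∀ᵐ x ∂(volume : Measure Plane), x i ≠ c := by
    rintro S hS rfl
    simpa [ae_iff] using hS
  fin_cases i
  · exact h (planeRect {c} Set.univ) (by simp [volume_planeRect]) (by ext; simp [planeRect])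
  · exact h (planeRect Set.univ {c}) (by simp [volume_planeRect]) (by ext; simp [planeRect])

/-- The sign of the derivative of the roof function. -/
noncomputable def roofSign (t : ℝ) : ℝ := if t < 1 / 2 then 1 else -1

theorem abs_roofSign (t : ℝ) : |roofSign t| = 1 := by
  unfold roofSign
  split_ifs <;> simp

theorem hasDerivAt_roof {t : ℝ} (ht : t ∈ Set.Ioo (0 : ℝ) 1) (hne : t ≠ 1 / 2) :
    HasDerivAt roof (roofSign t) t := by
  unfold roofSign
  split_ifs with h
  · exact hasDerivAt_roof_of_lt ht.1 h
  · exact hasDerivAt_roof_of_gt (lt_of_le_of_ne (not_lt.1 h) hne.symm) ht.2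

/-- Line derivatives of a sum of functions of the coordinates. -/
theorem hasLineDerivAt_add_coord {f h : ℝ → ℝ} {f' h' : ℝ} {x : Plane}
    (hf : HasDerivAt f f' (x 0)) (hh : HasDerivAt h h' (x 1)) :
    HasLineDerivAt ℝ (fun x : Plane => f (x 0) + h (x 1)) f' x (EuclideanSpace.single 0 1) ∧
      HasLineDerivAt ℝ (fun x : Plane => f (x 0) + h (x 1)) h' x (EuclideanSpace.single 1 1) := by
  constructor
  · have h1 : HasDerivAt (fun t : ℝ => f (x 0 + t)) f' 0 := by
      have := hf
      rw [← add_zero (x 0)] at this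
      exact this.comp_const_add (x 0) 0
    simpa [HasLineDerivAt] using h1.add_const (h (x 1))
  · have h1 : HasDerivAt (fun t : ℝ => h (x 1 + t)) h' 0 := by
      have := hh
      rw [← add_zero (x 1)] at this
      exact this.comp_const_add (x 1) 0
    simpa [HasLineDerivAt] using h1.const_add (f (x 0))

/-- The first component of the deformation. -/
noncomputable def branchFun (μ ρ : ℝ) (N J : ℕ) (x : Plane) : ℝ :=
  μ * x 0 + branching μ ρ N J x

/-- The gradient of the deformation. -/
noncomputable def branchGrad (μ ρ : ℝ) (N J : ℕ) (x : Plane) : Mat2 :=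
  !![lineDeriv ℝ (branchFun μ ρ N J) x (EuclideanSpace.single 0 1),
    lineDeriv ℝ (branchFun μ ρ N J) x (EuclideanSpace.single 1 1); 0, 0]

/-- The deformation. -/
noncomputable def branchMap (μ ρ : ℝ) (N J : ℕ) (x : Plane) : Plane := !₂[branchFun μ ρ N J x, 0]

variable {μ ρ : ℝ} {N J : ℕ}

theorem lipschitzWith_branchFun (hμ : |μ| < 1) (hρ : 1 < ρ) (hJ : ρ ^ J ≤ N) :
    LipschitzWith 4 (branchFun μ ρ N J) := by
  refine LipschitzWith.of_dist_le_mul fun x y => ?_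
  have h1 := (lipschitzWith_coord 0).dist_le_mul x y
  have h2 := (lipschitzWith_branching hμ hρ hJ).dist_le_mul x y
  simp only [Real.dist_eq, NNReal.coe_one, NNReal.coe_ofNat, one_mul] at h1 h2 ⊢
  have h3 : |μ * (x 0 - y 0)| ≤ |x 0 - y 0| := by
    rw [abs_mul]
    exact mul_le_of_le_one_left (abs_nonneg _) hμ.le
  have h4 := abs_add_le (μ * (x 0 - y 0)) (branching μ ρ N J x - branching μ ρ N J y)
  unfold branchFun
  rw [show μ * x 0 + branching μ ρ N J x - (μ * y 0 + branching μ ρ N J y) =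
    μ * (x 0 - y 0) + (branching μ ρ N J x - branching μ ρ N J y) by ring]
  linarith

/-- The points at which the gradient of the branching construction is computed. -/
structure IsRegularPoint (μ ρ : ℝ) (N J : ℕ) (x : Plane) : Prop where
  lineDifferentiableAt : ∀ j : Fin 2,
    LineDifferentiableAt ℝ (branchFun μ ρ N J) x (EuclideanSpace.single j 1)
  ne_half : x 1 ≠ 1 / 2
  ne_node : ∀ i ∈ branchIndex N J, x 0 ≠ node N i

theorem ae_isRegularPoint (hμ : |μ| < 1) (hρ : 1 < ρ) (hJ : ρ ^ J ≤ N) :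
    ∀ᵐ x ∂(volume : Measure Plane), IsRegularPoint μ ρ N J x := by
  have h1 : ∀ᵐ x ∂(volume : Measure Plane), ∀ j : Fin 2,
      LineDifferentiableAt ℝ (branchFun μ ρ N J) x (EuclideanSpace.single j 1) :=
    ae_all_iff.2 fun j => (lipschitzWith_branchFun hμ hρ hJ).ae_lineDifferentiableAt _
  have h2 : ∀ᵐ x ∂(volume : Measure Plane), ∀ i ∈ branchIndex N J, x 0 ≠ node N i :=
    (ae_ball_iff (branchIndex N J).countable_toSet).2 fun i _ => ae_coord_ne 0 _
  filter_upwards [h1, h2, ae_coord_ne 1 (1 / 2)] with x hx1 hx2 hx3 using ⟨hx1, hx3, hx2⟩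

/-- The deformation is touched from above by `μ x₀` plus one cone, whose derivative is explicit. The
first entry is exactly `±1`, so in the cones only the vertical slope costs elastic energy. -/
theorem branchGrad_of_eq_branchCone {x : Plane} (hx : IsRegularPoint μ ρ N J x)
    (hx1 : x 1 ∈ Set.Ioo (0 : ℝ) 1) {i : Σ _ : ℕ, ℕ} (hi : i ∈ branchIndex N J)
    (heq : branching μ ρ N J x = branchCone μ ρ N i x) :
    (node N i < x 0 → branchGrad μ ρ N J x 0 0 = 1) ∧
      (x 0 < node N i → branchGrad μ ρ N J x 0 0 = -1) ∧
      branchGrad μ ρ N J x 0 1 = branchSlope ρ N i.1 * roofSign (x 1) := by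
  have hle : ∀ y, branchFun μ ρ N J y ≤
      (μ * y 0 + cone μ (y 0 - node N i)) + branchSlope ρ N i.1 * roof (y 1) := fun y => by
    have := branching_le_branchCone (μ := μ) (ρ := ρ) hi y
    unfold branchCone at this
    unfold branchFun
    linarith
  have heq' : branchFun μ ρ N J x =
      (μ * x 0 + cone μ (x 0 - node N i)) + branchSlope ρ N i.1 * roof (x 1) := by
    rw [branchFun, heq, branchCone]
    ring
  have key : ∀ c, HasDerivAt (cone μ) c (x 0 - node N i) →
      branchGrad μ ρ N J x 0 0 = μ + c ∧
        branchGrad μ ρ N J x 0 1 = branchSlope ρ N i.1 * roofSign (x 1) := by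
    intro c hc
    have h1 : HasDerivAt (fun s => μ * s + cone μ (s - node N i)) (μ + c) (x 0) := by
      have h2 : HasDerivAt (fun s : ℝ => μ * s) μ (x 0) := by
        simpa using (hasDerivAt_id (x 0)).const_mul μ
      exact h2.fun_add (hc.comp_sub_const (x 0) (node N i))
    have h2 := hasLineDerivAt_add_coord (x := x) h1
      ((hasDerivAt_roof hx1 hx.ne_half).const_mul (branchSlope ρ N i.1))
    exact ⟨lineDeriv_eq_of_le (hx.lineDifferentiableAt 0) h2.1 hle heq',
      lineDeriv_eq_of_le (hx.lineDifferentiableAt 1) h2.2 hle heq'⟩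
  refine ⟨fun h => ?_, fun h => ?_, ?_⟩
  · rw [(key _ (hasDerivAt_cone_of_pos μ (sub_pos.2 h))).1]; ring
  · rw [(key _ (hasDerivAt_cone_of_neg μ (sub_neg.2 h))).1]; ring
  · rcases lt_or_gt_of_ne (hx.ne_node i hi) with h | h
    · exact (key _ (hasDerivAt_cone_of_neg μ (sub_neg.2 h))).2
    · exact (key _ (hasDerivAt_cone_of_pos μ (sub_pos.2 h))).2

theorem branchGrad_of_eq_roof {x : Plane} (hx : IsRegularPoint μ ρ N J x)
    (hx1 : x 1 ∈ Set.Ioo (0 : ℝ) 1) (heq : branching μ ρ N J x = 2 * roof (x 1)) :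
    branchGrad μ ρ N J x 0 0 = μ ∧ branchGrad μ ρ N J x 0 1 = 2 * roofSign (x 1) := by
  have hle : ∀ y, branchFun μ ρ N J y ≤ μ * y 0 + 2 * roof (y 1) := fun y =>
    add_le_add le_rfl (branching_le_roof y)
  have heq' : branchFun μ ρ N J x = μ * x 0 + 2 * roof (x 1) := by rw [branchFun, heq]
  have h1 : HasDerivAt (fun s : ℝ => μ * s) μ (x 0) := by
    simpa using (hasDerivAt_id (x 0)).const_mul μ
  have h2 := hasLineDerivAt_add_coord (x := x) h1
    ((hasDerivAt_roof hx1 hx.ne_half).const_mul 2)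
  exact ⟨lineDeriv_eq_of_le (hx.lineDifferentiableAt 0) h2.1 hle heq',
    lineDeriv_eq_of_le (hx.lineDifferentiableAt 1) h2.2 hle heq'⟩

theorem isWeakGradient_branchMap (hμ : |μ| < 1) (hρ : 1 < ρ) (hJ : ρ ^ J ≤ N) :
    IsWeakGradient (branchMap μ ρ N J) (branchGrad μ ρ N J) := by
  have h0 := HasWeakGradient.of_lipschitzWith (lipschitzWith_branchFun hμ hρ hJ)
  have hz : HasWeakGradient (fun _ => 0) (fun _ _ => 0) :=
    ⟨locallyIntegrable_const 0, fun _ => locallyIntegrable_const 0, fun _ _ => by simp⟩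
  have key : ∀ i : Fin 2, HasWeakGradient (fun x => branchMap μ ρ N J x i)
      (fun j x => branchGrad μ ρ N J x i j) := by
    intro i
    fin_cases i
    · have e : (fun (j : Fin 2) x => branchGrad μ ρ N J x 0 j) =
          fun j x => lineDeriv ℝ (branchFun μ ρ N J) x (EuclideanSpace.single j 1) := by
        funext j x
        fin_cases j <;> rfl
      rw [← e] at h0
      exact h0
    · have e : (fun (j : Fin 2) x => branchGrad μ ρ N J x 1 j) = fun _ _ => 0 := by
        funext j x
        fin_cases j <;> rfl
      rw [← e] at hz
      exact hz
  exact ⟨fun i => (key i).locallyIntegrable_fun, fun i => (key i).locallyIntegrable_grad,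
    fun i => (key i).integral_eq⟩

theorem abs_branchGrad_le (hμ : |μ| < 1) (hρ : 1 < ρ) (hJ : ρ ^ J ≤ N) (x : Plane)
    (i j : Fin 2) : |branchGrad μ ρ N J x i j| ≤ 4 := by
  have h : ∀ j : Fin 2,
      |lineDeriv ℝ (branchFun μ ρ N J) x (EuclideanSpace.single j 1)| ≤ 4 := by
    intro j
    have := norm_lineDeriv_le_of_lipschitz ℝ (lipschitzWith_branchFun (J := J) hμ hρ hJ)
      (x₀ := x) (v := EuclideanSpace.single j 1)
    simpa using this
  fin_cases i <;> fin_cases j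
  · exact h 0
  · exact h 1
  · simp [branchGrad]
  · simp [branchGrad]

theorem measurable_branchGrad (hμ : |μ| < 1) (hρ : 1 < ρ) (hJ : ρ ^ J ≤ N) (i j : Fin 2) :
    Measurable fun x => branchGrad μ ρ N J x i j := by
  have hc := (lipschitzWith_branchFun (J := J) hμ hρ hJ).continuous
  fin_cases i <;> fin_cases j
  · exact measurable_lineDeriv hc
  · exact measurable_lineDeriv hc
  · exact measurable_const
  · exact measurable_const

theorem branchMap_mem_admissible {p : ℝ} (hμ : |μ| < 1) (hρ : 1 < ρ) (hJ : ρ ^ J ≤ N) :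
    branchMap μ ρ N J ∈ admissible p !![μ, 0; 0, 0] := by
  refine ⟨⟨_, isWeakGradient_branchMap hμ hρ hJ, fun S hS => ⟨fun i => ?_, fun i j => ?_⟩⟩,
    0, .of_forall fun x hx => ?_⟩
  · have hcont : Continuous fun x => branchMap μ ρ N J x i := by
      fin_cases i
      · exact (lipschitzWith_branchFun hμ hρ hJ).continuous
      · exact continuous_const
    have : IsFiniteMeasure (volume.restrict S) := ⟨by simpa using hS.measure_lt_top⟩
    obtain ⟨C, hC⟩ := hS.exists_bound_of_continuousOn hcont.continuousOn
    exact MemLp.of_bound hcont.aestronglyMeasurable C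
      (by filter_upwards [self_mem_ae_restrict hS.measurableSet] with x hx using hC x hx)
  · have : IsFiniteMeasure (volume.restrict S) := ⟨by simpa using hS.measure_lt_top⟩
    exact MemLp.of_bound (measurable_branchGrad hμ hρ hJ i j).aestronglyMeasurable 4
      (.of_forall fun x => abs_branchGrad_le hμ hρ hJ x i j)
  · ext i
    fin_cases i <;>
      simp [branchMap, branchFun, branching_eq_zero hμ hρ hx, Matrix.toLpLin_apply, dotProduct,
        Fin.sum_univ_two]

end BranchingGradient

/-! ### Surface energy of the branching construction -/

section BranchingEnergy

theorem volume_roof_le (d : ℝ) :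
    volume {t : ℝ | t ∈ Set.Icc (0 : ℝ) 1 ∧ roof t ≤ d} ≤ ENNReal.ofReal (2 * d) := by
  have hsub : {t : ℝ | t ∈ Set.Icc (0 : ℝ) 1 ∧ roof t ≤ d} ⊆ Set.Icc 0 d ∪ Set.Icc (1 - d) 1 := by
    rintro t ⟨ht, hd⟩
    rw [roof_of_mem ht, min_le_iff] at hd
    rcases hd with h | h
    · exact Or.inl ⟨ht.1, h⟩
    · exact Or.inr ⟨by linarith, ht.2⟩
  refine (measure_mono hsub).trans ((measure_union_le _ _).trans ?_)
  rw [Real.volume_Icc, Real.volume_Icc]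
  rcases le_total 0 d with h | h
  · rw [← ENNReal.ofReal_add (by linarith) (by linarith)]
    exact ENNReal.ofReal_le_ofReal (by linarith)
  · rw [ENNReal.ofReal_of_nonpos (by linarith), ENNReal.ofReal_of_nonpos (by linarith)]
    simp

theorem measurableSet_roof_le (d : ℝ) : MeasurableSet {t : ℝ | roof t ≤ d} :=
  measurableSet_le lipschitzWith_roof.continuous.measurable measurable_const

theorem volume_unitSquare_roof_le (d : ℝ) :
    volume.restrict unitSquare {x : Plane | roof (x 1) ≤ d} ≤ ENNReal.ofReal (2 * d) := by
  have hm : MeasurableSet {x : Plane | roof (x 1) ≤ d} :=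
    measurableSet_le (lipschitzWith_roof.continuous.comp
      (lipschitzWith_coord 1).continuous).measurable measurable_const
  have he : {x : Plane | roof (x 1) ≤ d} ∩ unitSquare =
      planeRect (Set.Icc 0 1) {t : ℝ | t ∈ Set.Icc (0 : ℝ) 1 ∧ roof t ≤ d} := by
    rw [unitSquare_eq_planeRect]
    ext x
    exact ⟨fun h => ⟨h.2.1, h.2.2, h.1⟩, fun h => ⟨h.2.2, h.1, h.2.1⟩⟩
  rw [Measure.restrict_apply hm, he, volume_planeRect]
  simpa using volume_roof_le d

theorem setIntegral_indicator_roof_le {d : ℝ} (hd : 0 ≤ d) :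
    ∫ t in Set.Ioo (0 : ℝ) 1, {t : ℝ | roof t ≤ d}.indicator 1 t ≤ 2 * d := by
  rw [integral_indicator_one (measurableSet_roof_le d), Measure.real,
    Measure.restrict_apply (measurableSet_roof_le d)]
  refine ENNReal.toReal_le_of_le_ofReal (by linarith) (le_trans (measure_mono ?_)
    (volume_roof_le d))
  exact fun t ht => ⟨Set.Ioo_subset_Icc_self ht.2, ht.1⟩

variable {μ ρ : ℝ} {N J : ℕ}

theorem branchDepth_nonneg (hρ : 1 < ρ) (j : ℕ) : 0 ≤ branchDepth ρ j := by
  have : 0 < ρ - 1 := by linarith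
  have : 0 < ρ := by linarith
  unfold branchDepth
  positivity

/-- At height `t` only the generations whose depth reaches `roof t` can be minimal, and each of
their cones pays a bounded amount. -/
theorem variationLE_branchGrad_horizontal (hμ : |μ| < 1) (hρ : 1 < ρ) (hN : 0 < N)
    (hJ : ρ ^ J ≤ N) {t : ℝ} (ht : t ∈ Set.Ioo (0 : ℝ) 1)
    (hreg : ∀ᵐ s : ℝ, IsRegularPoint μ ρ N J !₂[s, t]) (j : Fin 2) :
    VariationLE (fun s => branchGrad μ ρ N J !₂[s, t] 0 j)
      (∑ i ∈ branchIndex N J, 8 * {t : ℝ | roof t ≤ branchDepth ρ i.1}.indicator 1 t) := by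
  classical
  set s' := (branchIndex N J).filter fun i => roof t ≤ branchDepth ρ i.1 with hs'
  have hactive : ∀ r ∈ Set.Ioo (0 : ℝ) 1, ∀ i ∈ branchIndex N J,
      (∀ k ∈ branchIndex N J, cone μ (r - node N i) + branchSlope ρ N i.1 * roof t ≤
        cone μ (r - node N k) + branchSlope ρ N k.1 * roof t) → i ∈ s' := by
    intro r hr i hi hmin
    refine Finset.mem_filter.2 ⟨hi, ?_⟩
    exact roof_le_branchDepth (x := !₂[r, t]) hμ hρ hN (Set.Ioo_subset_Icc_self hr) hi hmin
  have htouch : ∀ r ∈ Set.Ioo (0 : ℝ) 1, ∀ i ∈ branchIndex N J,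
      (∀ k ∈ branchIndex N J, cone μ (r - node N i) + branchSlope ρ N i.1 * roof t ≤
        cone μ (r - node N k) + branchSlope ρ N k.1 * roof t) →
      (cone μ (r - node N i) + branchSlope ρ N i.1 * roof t ≤ 2 * roof t →
        branching μ ρ N J !₂[r, t] = branchCone μ ρ N i !₂[r, t]) ∧
      (2 * roof t < cone μ (r - node N i) + branchSlope ρ N i.1 * roof t →
        branching μ ρ N J !₂[r, t] = 2 * roof t) := by
    intro r hr i hi hmin
    refine ⟨fun h => branching_eq_branchCone (x := !₂[r, t]) hμ hN
      (Set.Ioo_subset_Icc_self hr) hi hmin h, fun h => branching_eq_roof (x := !₂[r, t]) hμ hN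
      (Set.Ioo_subset_Icc_self hr) fun k hk => h.le.trans (hmin k hk)⟩
  have hsum : ∀ {c : (Σ _ : ℕ, ℕ) → ℝ}, (∀ i ∈ s', c i ≤ 8) → ∑ i ∈ s', c i ≤
      ∑ i ∈ branchIndex N J, 8 * {t : ℝ | roof t ≤ branchDepth ρ i.1}.indicator 1 t := by
    intro c hc
    refine (Finset.sum_le_sum hc).trans (le_of_eq ?_)
    rw [hs', Finset.sum_filter]
    refine Finset.sum_congr rfl fun i _ => ?_
    by_cases h : roof t ≤ branchDepth ρ i.1 <;> simp [h]
  obtain ⟨hμ1, hμ2⟩ := abs_lt.1 hμ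
  fin_cases j
  · refine (variationLE_of_cones (branchIndex_nonempty N J) (Finset.filter_subset _ _)
      (μ := μ) (γ := 2 * roof t) (c := μ) (y := node N)
      (τ := fun i => branchSlope ρ N i.1 * roof t) (a := fun _ => 1 - μ) (b := fun _ => -1 - μ)
      hactive ?_).mono (hsum fun i _ => ?_)
    · filter_upwards [hreg] with r hr hr01 i hi hmin
      obtain ⟨h1, h2⟩ := htouch r hr01 i hi hmin
      refine ⟨fun h => ?_, fun h => (branchGrad_of_eq_roof hr ht (h2 h)).1⟩
      have h3 := branchGrad_of_eq_branchCone hr ht hi (h1 h)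
      exact ⟨fun h4 => (h3.1 h4).trans (by ring), fun h4 => (h3.2.1 h4).trans (by ring)⟩
    -- The jumps `1 - μ` and `-1 - μ` from the base value `μ` cost `4` in all; the second entry,
    -- with two jumps of size at most `2`, needs the full `8`.
    · rw [abs_of_nonneg (by linarith : 0 ≤ 1 - μ), abs_of_nonpos (by linarith : -1 - μ ≤ 0)]
      linarith
  · refine (variationLE_of_cones (branchIndex_nonempty N J) (Finset.filter_subset _ _)
      (μ := μ) (γ := 2 * roof t) (c := 2 * roofSign t) (y := node N)
      (τ := fun i => branchSlope ρ N i.1 * roof t)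
      (a := fun i => (branchSlope ρ N i.1 - 2) * roofSign t)
      (b := fun i => (branchSlope ρ N i.1 - 2) * roofSign t) hactive ?_).mono
      (hsum fun i hi => ?_)
    · filter_upwards [hreg] with r hr hr01 i hi hmin
      obtain ⟨h1, h2⟩ := htouch r hr01 i hi hmin
      refine ⟨fun h => ?_, fun h => (branchGrad_of_eq_roof hr ht (h2 h)).2⟩
      have h3 : branchGrad μ ρ N J !₂[r, t] 0 1 =
          2 * roofSign t + (branchSlope ρ N i.1 - 2) * roofSign t := by
        have h4 : branchGrad μ ρ N J !₂[r, t] 0 1 = branchSlope ρ N i.1 * roofSign t :=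
          (branchGrad_of_eq_branchCone hr ht hi (h1 h)).2.2
        rw [h4]
        ring
      exact ⟨fun _ => h3, fun _ => h3⟩
    · have h1 := branchSlope_nonneg (N := N) hρ i.1
      have h2 := branchSlope_le_one hρ hJ (mem_branchIndex.1 (Finset.mem_filter.1 hi).1).1
      rw [abs_mul, abs_roofSign, abs_of_nonpos (by linarith)]
      linarith

/-- On a vertical line the minimum reduces to `J + 2` functions of the height: one cone for each
generation, and the cap. -/
theorem variationLE_branchGrad_vertical (hμ : |μ| < 1) (hρ : 1 < ρ) (hN : 0 < N)
    (hJ : ρ ^ J ≤ N) {s : ℝ} (hs : s ∈ Set.Ioo (0 : ℝ) 1)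
    (hreg : ∀ᵐ t : ℝ, IsRegularPoint μ ρ N J !₂[s, t]) (j : Fin 2) :
    VariationLE (fun t => branchGrad μ ρ N J !₂[s, t] 0 j) (8 * (J + 2)) := by
  classical
  -- Within a generation the cones differ only in the vertex, so at fixed `s` the best one is the
  -- same for all `t`.
  have hk : ∀ j : ℕ, ∃ k ∈ Finset.range (N * 2 ^ j + 1), ∀ l ∈ Finset.range (N * 2 ^ j + 1),
      cone μ (s - node N ⟨j, k⟩) ≤ cone μ (s - node N ⟨j, l⟩) := fun j =>
    Finset.exists_min_image _ (fun k => cone μ (s - node N ⟨j, k⟩)) ⟨0, by simp⟩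
  choose k hkm hkmin using hk
  -- The index `none` stands for the cap, with offset `0` and slope `2`.
  set S : Option ℕ → ℝ := fun o => o.elim 0 fun j => cone μ (s - node N ⟨j, k j⟩) with hS
  set σ : Option ℕ → ℝ := fun o => o.elim 2 fun j => branchSlope ρ N j with hσ
  set I : Finset (Option ℕ) := Finset.insertNone (Finset.range (J + 1)) with hI
  have hIne : I.Nonempty := ⟨none, by simp [hI]⟩
  have hsome : ∀ {j : ℕ}, some j ∈ I ↔ j ≤ J := by
    intro j
    simp [hI]
  have hidx : ∀ {j : ℕ}, j ≤ J → (⟨j, k j⟩ : Σ _ : ℕ, ℕ) ∈ branchIndex N J := fun {j} hj =>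
    mem_branchIndex.2 ⟨hj, Nat.lt_succ_iff.1 (Finset.mem_range.1 (hkm j))⟩
  have htouch : ∀ t ∈ Set.Ioo (0 : ℝ) 1, ∀ o ∈ I,
      (∀ l ∈ I, S o + σ o * min t (1 - t) ≤ S l + σ l * min t (1 - t)) →
      branching μ ρ N J !₂[s, t] = o.elim (2 * roof t)
        fun j => branchCone μ ρ N ⟨j, k j⟩ !₂[s, t] := by
    intro t ht o ho hmin
    rw [← roof_of_mem (Set.Ioo_subset_Icc_self ht)] at hmin
    have hmin' : ∀ l ∈ branchIndex N J, S o + σ o * roof t ≤ branchCone μ ρ N l !₂[s, t] := by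
      rintro ⟨l, m⟩ hl
      obtain ⟨h1, h2⟩ := mem_branchIndex.1 hl
      refine (hmin (some l) (hsome.2 h1)).trans (add_le_add ?_ le_rfl)
      exact hkmin l m (Finset.mem_range.2 (Nat.lt_succ_iff.2 h2))
    have hnone := hmin none (by simp [hI])
    cases o with
    | none =>
      refine branching_eq_roof (x := !₂[s, t]) hμ hN (Set.Ioo_subset_Icc_self hs) fun l hl => ?_
      simpa [hS, hσ] using hmin' l hl
    | some j =>
      refine branching_eq_branchCone (x := !₂[s, t]) hμ hN (Set.Ioo_subset_Icc_self hs)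
        (hidx (hsome.1 ho)) (fun l hl => hmin' l hl) ?_
      simpa [hS, hσ, branchCone] using hnone
  have hsum : ∀ {c : Option ℕ → ℝ}, (∀ o ∈ I, c o ≤ 8) → ∑ o ∈ I, c o ≤ 8 * (J + 2) := by
    intro c hc
    refine (Finset.sum_le_card_nsmul I c 8 hc).trans (le_of_eq ?_)
    simp only [hI, Finset.card_insertNone, Finset.card_range, nsmul_eq_mul]
    push_cast
    ring
  obtain ⟨hμ1, hμ2⟩ := abs_lt.1 hμ
  fin_cases j
  · refine (variationLE_of_roofs hIne (S := S) (σ := σ)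
      (a := fun o => o.elim μ fun j => if node N ⟨j, k j⟩ < s then 1 else -1)
      (b := fun o => o.elim μ fun j => if node N ⟨j, k j⟩ < s then 1 else -1) ?_).mono
      (hsum fun o ho => ?_)
    · filter_upwards [hreg] with t ht ht01 o ho hmin
      have h1 := htouch t ht01 o ho hmin
      suffices h : branchGrad μ ρ N J !₂[s, t] 0 0 =
          o.elim μ fun j => if node N ⟨j, k j⟩ < s then 1 else -1 from ⟨fun _ => h, fun _ => h⟩
      cases o with
      | none => exact (branchGrad_of_eq_roof ht ht01 h1).1
      | some j =>
        have hm := hidx (hsome.1 ho)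
        have h3 := branchGrad_of_eq_branchCone ht ht01 hm h1
        rcases lt_or_gt_of_ne (ht.ne_node _ hm) with h | h
        · rw [h3.2.1 h]
          exact (if_neg (lt_asymm h)).symm
        · rw [h3.1 h]
          exact (if_pos h).symm
    · cases o with
      | none => simp only [Option.elim_none]; linarith
      | some j =>
        simp only [Option.elim_some]
        split_ifs <;> norm_num
  · refine (variationLE_of_roofs hIne (S := S) (σ := σ) (a := σ) (b := fun o => -σ o) ?_).mono
      (hsum fun o ho => ?_)
    · filter_upwards [hreg] with t ht ht01 o ho hmin
      have h1 := htouch t ht01 o ho hmin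
      have h : branchGrad μ ρ N J !₂[s, t] 0 1 = σ o * roofSign t := by
        cases o with
        | none => exact (branchGrad_of_eq_roof ht ht01 h1).2
        | some j => exact (branchGrad_of_eq_branchCone ht ht01 (hidx (hsome.1 ho)) h1).2.2
      refine ⟨fun hlt => ?_, fun hgt => ?_⟩
      · exact h.trans (by rw [roofSign, if_pos hlt, mul_one])
      · exact h.trans (by rw [roofSign, if_neg (lt_asymm hgt), mul_neg_one])
    · have h1 : |σ o| ≤ 2 := by
        cases o with
        | none => simp [hσ]
        | some j =>
          have h1 := branchSlope_nonneg (N := N) hρ j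
          have h2 := branchSlope_le_one hρ hJ (hsome.1 ho)
          simp only [hσ, Option.elim_some]
          rw [abs_of_nonneg h1]
          linarith
      rw [abs_neg]
      linarith

theorem totalVariation_branchGrad_le (hμ : |μ| < 1) (hρ : 1 < ρ) (hN : 0 < N) (hJ : ρ ^ J ≤ N) :
    totalVariation openUnitSquare (branchGrad μ ρ N J) ≤
      ENNReal.ofReal (2 * ((∑ i ∈ branchIndex N J, 16 * branchDepth ρ i.1) + 8 * (J + 2))) := by
  have hreg := ae_ae_of_ae_plane (ae_isRegularPoint (J := J) hμ hρ hJ)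
  have hvol : volume (openUnitSquare : Set Plane) ≠ ⊤ := by
    refine ne_top_of_le_ne_top ?_ (measure_mono openUnitSquare_subset_unitSquare)
    simp [volume_unitSquare]
  have hG : ∀ j, IntegrableOn (fun x => branchGrad μ ρ N J x 0 j) openUnitSquare := fun j =>
    Measure.integrableOn_of_bounded (M := 4) hvol
      (measurable_branchGrad hμ hρ hJ 0 j).aestronglyMeasurable
      (.of_forall fun x => abs_branchGrad_le hμ hρ hJ x 0 j)
  have hi : ∀ d : ℝ, IntegrableOn ({t : ℝ | roof t ≤ d}.indicator (1 : ℝ → ℝ)) (Set.Ioo 0 1) :=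
    fun d => Integrable.indicator (integrableOn_const (C := (1 : ℝ)) (by simp))
      (measurableSet_roof_le d)
  have hB : IntegrableOn (fun t => ∑ i ∈ branchIndex N J,
      8 * {t : ℝ | roof t ≤ branchDepth ρ i.1}.indicator (1 : ℝ → ℝ) t) (Set.Ioo 0 1) :=
    integrable_finsetSum _ fun i _ => (hi _).const_mul 8
  have hD : IntegrableOn (fun _ : ℝ => 8 * ((J : ℝ) + 2)) (Set.Ioo 0 1) :=
    integrableOn_const (by simp)
  refine (totalVariation_le_of_slices (fun x j => by fin_cases j <;> rfl) hG hB hD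
    (fun j => ?_) fun j => ?_).trans (ENNReal.ofReal_le_ofReal ?_)
  · filter_upwards [hreg.2] with t ht ht01
    exact variationLE_branchGrad_horizontal hμ hρ hN hJ ht01 ht j
  · filter_upwards [hreg.1] with s hs hs01
    exact variationLE_branchGrad_vertical hμ hρ hN hJ hs01 hs j
  · refine mul_le_mul_of_nonneg_left (add_le_add ?_ ?_) zero_le_two
    · rw [integral_finsetSum _ fun i _ => (hi _).const_mul 8]
      refine Finset.sum_le_sum fun i _ => ?_
      rw [integral_const_mul]
      linarith [setIntegral_indicator_roof_le (branchDepth_nonneg hρ i.1)]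
    · simp

end BranchingEnergy

/-! ### Elastic energy of the branching construction -/

section UpperBound

theorem frobenius_norm_le_add (a b : ℝ) : ‖(!![a, b; 0, 0] : Mat2)‖ ≤ |a| + |b| := by
  rw [Matrix.frobenius_norm_def, ← Real.sqrt_eq_rpow]
  refine Real.sqrt_le_iff.2 ⟨by positivity, ?_⟩
  simp only [Fin.sum_univ_two, Matrix.of_apply, Matrix.cons_val', Matrix.cons_val_zero,
    Matrix.cons_val_one, Matrix.cons_val_fin_one, Real.norm_eq_abs, Real.rpow_two, abs_zero]
  nlinarith [abs_nonneg a, abs_nonneg b, mul_nonneg (abs_nonneg a) (abs_nonneg b)]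

variable {μ ρ p : ℝ} {N J : ℕ}

theorem infEDist_branchGrad_le {x : Plane} {B : Mat2} (hB : B ∈ wellsK2) :
    Metric.infEDist (branchGrad μ ρ N J x) wellsK2 ≤
      ENNReal.ofReal (|branchGrad μ ρ N J x 0 0 - B 0 0| + |branchGrad μ ρ N J x 0 1|) := by
  refine (Metric.infEDist_le_edist_of_mem hB).trans ?_
  rw [edist_dist, dist_eq_norm]
  refine ENNReal.ofReal_le_ofReal (le_trans (le_of_eq ?_) (frobenius_norm_le_add _ _))
  congr 1
  ext i j
  rcases hB with rfl | rfl <;> fin_cases i <;> fin_cases j <;> simp [branchGrad]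

/-- Pointwise bound of the elastic energy density. -/
theorem infEDist_branchGrad_rpow_le (hp : 0 ≤ p) (hμ : |μ| < 1) (hρ : 1 < ρ) (hN : 0 < N)
    (hJ : ρ ^ J ≤ N) {x : Plane} (hx : IsRegularPoint μ ρ N J x)
    (h0 : x 0 ∈ Set.Ioo (0 : ℝ) 1) (h1 : x 1 ∈ Set.Ioo (0 : ℝ) 1) :
    Metric.infEDist (branchGrad μ ρ N J x) wellsK2 ^ p ≤
      (∑ j ∈ Finset.range (J + 1), {x : Plane | roof (x 1) ≤ branchDepth ρ j}.indicator
        (fun _ => ENNReal.ofReal (branchSlope ρ N j ^ p)) x) +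
      {x : Plane | roof (x 1) ≤ 2 / (N * 2 ^ J)}.indicator
        (fun _ => ENNReal.ofReal (4 ^ p)) x := by
  have h0' := Set.Ioo_subset_Icc_self h0
  obtain ⟨i, hi, hmin⟩ := Finset.exists_min_image (branchIndex N J)
    (fun i => branchCone μ ρ N i x) (branchIndex_nonempty N J)
  rcases le_or_gt (branchCone μ ρ N i x) (2 * roof (x 1)) with hle | hlt
  · have hs := branchSlope_nonneg (N := N) hρ i.1
    obtain ⟨g1, g2, g3⟩ := branchGrad_of_eq_branchCone hx h1 hi
      (branching_eq_branchCone hμ hN h0' hi hmin hle)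
    have hd : Metric.infEDist (branchGrad μ ρ N J x) wellsK2 ≤
        ENNReal.ofReal (branchSlope ρ N i.1) := by
      have g4 : |branchGrad μ ρ N J x 0 1| = branchSlope ρ N i.1 := by
        rw [g3, abs_mul, abs_roofSign, abs_of_nonneg hs, mul_one]
      rcases lt_or_gt_of_ne (hx.ne_node i hi) with h | h
      · refine (infEDist_branchGrad_le (B := !![-1, 0; 0, 0]) (Or.inr rfl)).trans ?_
        rw [g4, g2 h]
        simp
      · refine (infEDist_branchGrad_le (B := !![1, 0; 0, 0]) (Or.inl rfl)).trans ?_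
        rw [g4, g1 h]
        simp
    refine le_add_right (le_trans ?_ (Finset.single_le_sum (f := fun j =>
      {x : Plane | roof (x 1) ≤ branchDepth ρ j}.indicator
        (fun _ => ENNReal.ofReal (branchSlope ρ N j ^ p)) x) (fun _ _ => zero_le)
      (Finset.mem_range.2 (Nat.lt_succ_iff.2 (mem_branchIndex.1 hi).1))))
    have hm : x ∈ {x : Plane | roof (x 1) ≤ branchDepth ρ i.1} :=
      roof_le_branchDepth hμ hρ hN h0' hi hmin
    simp only
    rw [Set.indicator_of_mem hm, ← ENNReal.ofReal_rpow_of_nonneg hs hp]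
    exact ENNReal.rpow_le_rpow hd hp
  -- In the layer of the cap the gradient is not near the wells: `|μ - 1| + 2 ≤ 4` is used there.
  · have hmin' : ∀ k ∈ branchIndex N J, 2 * roof (x 1) ≤ branchCone μ ρ N k x :=
      fun k hk => hlt.le.trans (hmin k hk)
    obtain ⟨g1, g2⟩ := branchGrad_of_eq_roof hx h1 (branching_eq_roof hμ hN h0' hmin')
    have hm : x ∈ {x : Plane | roof (x 1) ≤ 2 / (N * 2 ^ J)} :=
      roof_le_of_lt_branchCone hμ hρ hN hJ h0' hmin'
    refine le_add_left ?_
    rw [Set.indicator_of_mem hm, ← ENNReal.ofReal_rpow_of_nonneg (by norm_num) hp]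
    refine ENNReal.rpow_le_rpow ((infEDist_branchGrad_le (B := !![1, 0; 0, 0])
      (Or.inl rfl)).trans (ENNReal.ofReal_le_ofReal ?_)) hp
    rw [g1, g2, abs_mul, abs_roofSign, abs_two]
    have : |μ - 1| ≤ |μ| + |1| := abs_sub _ _
    rw [abs_one] at this
    simp only [Matrix.of_apply, Matrix.cons_val', Matrix.cons_val_zero]
    linarith

theorem lintegral_infEDist_branchGrad_le (hp : 0 ≤ p) (hμ : |μ| < 1) (hρ : 1 < ρ) (hN : 0 < N)
    (hJ : ρ ^ J ≤ N) :
    ∫⁻ x in unitSquare, Metric.infEDist (branchGrad μ ρ N J x) wellsK2 ^ p ≤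
      ENNReal.ofReal ((∑ j ∈ Finset.range (J + 1), branchSlope ρ N j ^ p * (2 * branchDepth ρ j)) +
        4 ^ p * (2 * (2 / (N * 2 ^ J)))) := by
  have hm : ∀ d : ℝ, MeasurableSet {x : Plane | roof (x 1) ≤ d} := fun d =>
    measurableSet_le (lipschitzWith_roof.continuous.comp
      (lipschitzWith_coord 1).continuous).measurable measurable_const
  have hI : ∀ c d : ℝ, 0 ≤ c → ∫⁻ x in unitSquare, {x : Plane | roof (x 1) ≤ d}.indicator
      (fun _ => ENNReal.ofReal c) x ≤ ENNReal.ofReal (c * (2 * d)) := by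
    intro c d hc
    rw [lintegral_indicator_const (hm d), ENNReal.ofReal_mul hc]
    gcongr
    exact volume_unitSquare_roof_le d
  have hs : ∀ j, 0 ≤ branchSlope ρ N j ^ p := fun j =>
    Real.rpow_nonneg (branchSlope_nonneg hρ j) p
  have hd : ∀ j, 0 ≤ 2 * branchDepth ρ j := fun j =>
    mul_nonneg zero_le_two (branchDepth_nonneg hρ j)
  have hae : ∀ᵐ x ∂(volume.restrict unitSquare), x 0 ∈ Set.Ioo (0 : ℝ) 1 ∧
      x 1 ∈ Set.Ioo (0 : ℝ) 1 ∧ IsRegularPoint μ ρ N J x := by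
    filter_upwards [self_mem_ae_restrict measurableSet_unitSquare,
      ae_restrict_of_ae (ae_coord_ne 0 0), ae_restrict_of_ae (ae_coord_ne 0 1),
      ae_restrict_of_ae (ae_coord_ne 1 0), ae_restrict_of_ae (ae_coord_ne 1 1),
      ae_restrict_of_ae (ae_isRegularPoint hμ hρ hJ)] with x hx h1 h2 h3 h4 h5
    exact ⟨⟨lt_of_le_of_ne (hx 0).1 h1.symm, lt_of_le_of_ne (hx 0).2 h2⟩,
      ⟨lt_of_le_of_ne (hx 1).1 h3.symm, lt_of_le_of_ne (hx 1).2 h4⟩, h5⟩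
  refine (lintegral_mono_ae (hae.mono fun x hx =>
    infEDist_branchGrad_rpow_le hp hμ hρ hN hJ hx.2.2 hx.1 hx.2.1)).trans ?_
  rw [lintegral_add_right _ (measurable_const.indicator (hm _)),
    lintegral_finsetSum _ fun j _ => measurable_const.indicator (hm _),
    ENNReal.ofReal_add (Finset.sum_nonneg fun j _ => mul_nonneg (hs j) (hd j)) (by positivity),
    ENNReal.ofReal_sum_of_nonneg fun j _ => mul_nonneg (hs j) (hd j)]
  exact add_le_add (Finset.sum_le_sum fun j _ => hI _ _ (hs j)) (hI _ _ (by positivity))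

end UpperBound

/-! ### Choice of the parameters and the scaling law -/

section ScalingLaw

theorem sum_inv_pow_le {ρ : ℝ} (hρ : 1 < ρ) (n : ℕ) :
    ∑ j ∈ Finset.range n, (ρ⁻¹) ^ j ≤ (1 - ρ⁻¹)⁻¹ := by
  have h0 : 0 ≤ ρ⁻¹ := inv_nonneg.2 (by linarith)
  have h1 : ρ⁻¹ < 1 := inv_lt_one_of_one_lt₀ hρ
  rw [← tsum_geometric_of_lt_one h0 h1]
  exact (summable_geometric_of_lt_one h0 h1).sum_le_tsum _ fun _ _ => by positivity

/-- The energy of the branching construction with `N` cells in the middle. -/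
theorem exists_minEnergy_le_of_nat {p μ : ℝ} (hp : 1 ≤ p) (hμ : |μ| < 1) :
    ∃ C₁ C₂ : ℝ, 0 ≤ C₁ ∧ 0 ≤ C₂ ∧ ∀ N : ℕ, 0 < N → ∀ ε : ℝ, 0 ≤ ε →
      minEnergy wellsK2 p ε !![μ, 0; 0, 0] ≤
        ENNReal.ofReal (C₁ * ((N : ℝ) ^ p)⁻¹ + ε * (C₂ * N)) := by
  have hp0 : 0 < p := by linarith
  -- With `ρ^p = 2`, both the elastic ratio `ρ^p/(2ρ)` and the surface ratio `2/(2ρ)` are equal to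
  -- `1/ρ < 1`.
  obtain ⟨ρ, hρ, hρp⟩ : ∃ ρ : ℝ, 1 < ρ ∧ ρ ^ p = 2 :=
    ⟨2 ^ (1 / p), Real.one_lt_rpow one_lt_two (by positivity), by
      rw [← Real.rpow_mul zero_le_two, one_div_mul_cancel hp0.ne', Real.rpow_one]⟩
  have hρ0 : 0 < ρ := by linarith
  have hρ1 : 0 < ρ - 1 := by linarith
  set K : ℝ := 4 * ρ / (ρ - 1) with hK
  have hK0 : 0 ≤ K := by positivity
  set S : ℝ := (1 - ρ⁻¹)⁻¹ with hS
  have hS0 : 0 ≤ S := inv_nonneg.2 (sub_nonneg.2 (inv_le_one_of_one_le₀ hρ.le))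
  refine ⟨2 * K * S + 8 * 4 ^ p, 2 * (32 * K * S + (8 / (ρ - 1) + 16)), by positivity,
    by positivity, fun N hN ε hε => ?_⟩
  have hN1 : (1 : ℝ) ≤ N := by exact_mod_cast hN
  have hN0 : (0 : ℝ) < N := by linarith
  have hNp : (0 : ℝ) < (N : ℝ) ^ p := Real.rpow_pos_of_pos hN0 p
  -- The largest `J` with `ρ^J ≤ N`. Maximality gives `N^p ≤ 2 · 2^J`, so the layer of the cap has
  -- energy of order `N^(-p)`.
  obtain ⟨J, hJ, hJ'⟩ := exists_nat_pow_near hN1 hρ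
  have hpow : ∀ j : ℕ, (ρ ^ j) ^ p = 2 ^ j := fun j => by
    rw [← Real.rpow_natCast, ← Real.rpow_mul hρ0.le, mul_comm, Real.rpow_mul hρ0.le, hρp,
      Real.rpow_natCast]
  have hJ2 : (N : ℝ) ^ p ≤ 2 * 2 ^ J := by
    have := Real.rpow_le_rpow hN0.le hJ'.le hp0.le
    rwa [hpow, pow_succ, mul_comm] at this
  -- Bernoulli's inequality; the vertical slices then cost at most a multiple of `N`.
  have hJN : (J : ℝ) ≤ N / (ρ - 1) := by
    have := one_add_mul_sub_le_pow (by linarith : (-1 : ℝ) ≤ ρ) J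
    rw [le_div_iff₀ hρ1]
    linarith
  have helastic : (∑ j ∈ Finset.range (J + 1), branchSlope ρ N j ^ p * (2 * branchDepth ρ j)) +
      4 ^ p * (2 * (2 / (N * 2 ^ J))) ≤ (2 * K * S + 8 * 4 ^ p) * ((N : ℝ) ^ p)⁻¹ := by
    have h1 : ∑ j ∈ Finset.range (J + 1), branchSlope ρ N j ^ p * (2 * branchDepth ρ j) ≤
        2 * K * ((N : ℝ) ^ p)⁻¹ * S := by
      refine le_trans ?_ (mul_le_mul_of_nonneg_left (sum_inv_pow_le hρ (J + 1)) (by positivity))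
      rw [Finset.mul_sum]
      refine Finset.sum_le_sum fun j _ => ?_
      have h2 : branchSlope ρ N j ^ p ≤ 2 ^ j / (N : ℝ) ^ p := by
        rw [← hpow, ← Real.div_rpow (by positivity) hN0.le]
        exact Real.rpow_le_rpow (branchSlope_nonneg hρ j) (branchSlope_le j) hp0.le
      refine (mul_le_mul_of_nonneg_right h2
        (mul_nonneg zero_le_two (branchDepth_nonneg hρ j))).trans (le_of_eq ?_)
      rw [branchDepth, ← hK, mul_pow, inv_pow]
      field_simp
    have h2 : (4 : ℝ) ^ p * (2 * (2 / (N * 2 ^ J))) ≤ 8 * 4 ^ p * ((N : ℝ) ^ p)⁻¹ := by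
      have h3 : 2 / (N * 2 ^ J) ≤ 4 * ((N : ℝ) ^ p)⁻¹ := by
        rw [← div_eq_mul_inv, div_le_div_iff₀ (by positivity) hNp]
        have : (1 : ℝ) * 2 ^ J ≤ N * 2 ^ J := mul_le_mul_of_nonneg_right hN1 (by positivity)
        linarith
      calc (4 : ℝ) ^ p * (2 * (2 / (N * 2 ^ J))) ≤ 4 ^ p * (2 * (4 * ((N : ℝ) ^ p)⁻¹)) := by gcongr
        _ = _ := by ring
    calc _ ≤ _ := add_le_add h1 h2
      _ = _ := by ring
  have hsurface : 2 * ((∑ i ∈ branchIndex N J, 16 * branchDepth ρ i.1) + 8 * (J + 2)) ≤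
      2 * (32 * K * S + (8 / (ρ - 1) + 16)) * N := by
    have h1 : ∑ i ∈ branchIndex N J, 16 * branchDepth ρ i.1 ≤ 32 * K * N * S := by
      rw [branchIndex, Finset.sum_sigma]
      refine le_trans ?_ (mul_le_mul_of_nonneg_left (sum_inv_pow_le hρ (J + 1)) (by positivity))
      rw [Finset.mul_sum]
      refine Finset.sum_le_sum fun j _ => ?_
      simp only [Finset.sum_const, Finset.card_range, nsmul_eq_mul]
      push_cast
      have h2 : (N : ℝ) * 2 ^ j + 1 ≤ 2 * (N * 2 ^ j) := by
        have : (1 : ℝ) ≤ N * 2 ^ j := one_le_mul_of_one_le_of_one_le hN1 (one_le_pow₀ one_le_two)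
        linarith
      refine (mul_le_mul_of_nonneg_right h2
        (mul_nonneg (by norm_num) (branchDepth_nonneg hρ j))).trans (le_of_eq ?_)
      rw [branchDepth, ← hK, mul_pow, inv_pow]
      field_simp
      ring
    have h2 : 8 * ((J : ℝ) + 2) ≤ (8 / (ρ - 1) + 16) * N := by
      have : (8 / (ρ - 1) + 16) * N = 8 * (N / (ρ - 1)) + 16 * N := by ring
      rw [this]
      linarith
    calc _ ≤ 2 * (32 * K * N * S + (8 / (ρ - 1) + 16) * N) := by gcongr
      _ = _ := by ring
  calc minEnergy wellsK2 p ε !![μ, 0; 0, 0]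
      ≤ energy wellsK2 p ε (branchMap μ ρ N J) :=
        iInf₂_le _ (branchMap_mem_admissible hμ hρ hJ)
    _ ≤ gradEnergy wellsK2 p ε (branchGrad μ ρ N J) :=
        iInf₂_le _ (isWeakGradient_branchMap hμ hρ hJ)
    _ ≤ ENNReal.ofReal ((2 * K * S + 8 * 4 ^ p) * ((N : ℝ) ^ p)⁻¹) +
        ENNReal.ofReal ε *
          ENNReal.ofReal (2 * (32 * K * S + (8 / (ρ - 1) + 16)) * N) := by
        refine add_le_add ((lintegral_infEDist_branchGrad_le hp0.le hμ hρ hN hJ).trans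
          (ENNReal.ofReal_le_ofReal helastic)) ?_
        gcongr
        exact (totalVariation_branchGrad_le hμ hρ hN hJ).trans (ENNReal.ofReal_le_ofReal hsurface)
    _ = _ := by
        rw [← ENNReal.ofReal_mul hε, ← ENNReal.ofReal_add (by positivity) (by positivity)]

/-- The upper bound in the scaling law. -/
theorem exists_minEnergy_le_ofReal {p μ : ℝ} (hp : 1 ≤ p) (hμ : |μ| < 1) :
    ∃ C : ℝ, ∀ ε ∈ Set.Ioo (0 : ℝ) 1,
      minEnergy wellsK2 p ε !![μ, 0; 0, 0] ≤ ENNReal.ofReal (C * ε ^ (p / (p + 1))) := by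
  obtain ⟨C₁, C₂, hC₁, hC₂, h⟩ := exists_minEnergy_le_of_nat hp hμ
  refine ⟨C₁ + 2 * C₂, fun ε hε => ?_⟩
  have hε0 := hε.1
  have hp1 : p + 1 ≠ 0 := by positivity
  -- The real number at which `y^(-p)` and `ε y` coincide. Since `y ≥ 1`, rounding up to an integer
  -- at most doubles it.
  set y : ℝ := ε ^ (-(1 / (p + 1))) with hy
  have hy1 : 1 ≤ y := Real.one_le_rpow_of_pos_of_le_one_of_nonpos hε0 hε.2.le
    (neg_nonpos.2 (by positivity))
  have hyp : (y ^ p)⁻¹ = ε ^ (p / (p + 1)) := by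
    rw [← Real.rpow_neg (by positivity), hy, ← Real.rpow_mul hε0.le]
    congr 1
    ring
  have hεy : ε * y = ε ^ (p / (p + 1)) := by
    rw [hy]
    nth_rewrite 1 [← Real.rpow_one ε]
    rw [← Real.rpow_add hε0]
    congr 1
    field_simp
    ring
  have hN := Nat.ceil_pos.2 (by linarith : 0 < y)
  have hle : y ≤ ⌈y⌉₊ := Nat.le_ceil y
  have hlt : (⌈y⌉₊ : ℝ) ≤ 2 * y := by linarith [Nat.ceil_lt_add_one (by linarith : 0 ≤ y)]
  refine (h _ hN ε hε0.le).trans (ENNReal.ofReal_le_ofReal ?_)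
  calc C₁ * ((⌈y⌉₊ : ℝ) ^ p)⁻¹ + ε * (C₂ * ⌈y⌉₊) ≤ C₁ * (y ^ p)⁻¹ + ε * (C₂ * (2 * y)) := by
        have : 0 < y ^ p := Real.rpow_pos_of_pos (by linarith) p
        gcongr
    _ = C₁ * (y ^ p)⁻¹ + 2 * C₂ * (ε * y) := by ring
    _ = (C₁ + 2 * C₂) * ε ^ (p / (p + 1)) := by rw [hyp, hεy]; ring

/-- The lamination convex hull of the two wells consists of diagonal matrices. -/
theorem exists_eq_of_mem_laminates_wellsK2 (n : ℕ) {F : Mat2} (hF : F ∈ laminates wellsK2 n) :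
    ∃ μ : ℝ, |μ| ≤ 1 ∧ F = !![μ, 0; 0, 0] := by
  induction n generalizing F with
  | zero =>
    rcases hF with rfl | rfl
    · exact ⟨1, by simp, rfl⟩
    · exact ⟨-1, by simp, rfl⟩
  | succ n ih =>
    rcases hF with hF | ⟨A, hA, B, hB, t, ht, -, rfl⟩
    · exact ih hF
    · obtain ⟨a, ha, rfl⟩ := ih hA
      obtain ⟨b, hb, rfl⟩ := ih hB
      refine ⟨t * a + (1 - t) * b, ?_, ?_⟩
      · obtain ⟨a1, a2⟩ := abs_le.1 ha
        obtain ⟨b1, b2⟩ := abs_le.1 hb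
        have h0 := ht.1
        have h1 : 0 ≤ 1 - t := by linarith [ht.2]
        rw [abs_le]
        constructor <;> nlinarith
      · ext i j
        fin_cases i <;> fin_cases j <;> simp

end ScalingLaw

theorem mainTheorem4 (p : ℝ) (hp : 1 ≤ p) (F : Mat2)
    (hF : F ∈ laminationConvexHull wellsK2 \ wellsK2) :
    ∃ c C : ℝ, 0 < c ∧ c ≤ C ∧ ∀ ε ∈ Set.Ioo (0 : ℝ) 1,
      ENNReal.ofReal (c * ε ^ (p / (p + 1))) ≤ minEnergy wellsK2 p ε F ∧
      minEnergy wellsK2 p ε F ≤ ENNReal.ofReal (C * ε ^ (p / (p + 1))) := by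
  obtain ⟨hF1, hF2⟩ := hF
  obtain ⟨n, hn⟩ := Set.mem_iUnion.1 hF1
  obtain ⟨μ, hμ1, rfl⟩ := exists_eq_of_mem_laminates_wellsK2 n hn
  have hμ : |μ| < 1 := by
    refine lt_of_le_of_ne hμ1 fun h => hF2 ?_
    rcases eq_or_eq_neg_of_abs_eq h with rfl | rfl
    · exact Or.inl rfl
    · exact Or.inr rfl
  obtain ⟨c, hc, hlower⟩ := exists_ofReal_le_minEnergy hp hμ
  obtain ⟨C, hupper⟩ := exists_minEnergy_le_ofReal hp hμ
  -- The maximum secures the required ordering of the two constants.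
  refine ⟨c, max c C, hc, le_max_left _ _, fun ε hε => ⟨hlower ε hε, (hupper ε hε).trans ?_⟩⟩
  have := Real.rpow_nonneg hε.1.le (p / (p + 1))
  exact ENNReal.ofReal_le_ofReal (mul_le_mul_of_nonneg_right (le_max_right _ _) this)
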